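/- Let $d\ge 2$ and let $g$ be the Coulomb kernel on $\mathbf R^d$, i.e. $g(x)=\bar c_d\,|x|^{2-d}$ if $d\ge 3$ and $g(x)=-\bar c_2\log|x|$ if $d=2$, where $\bar c_d>0$ is the constant for which $-\Delta g=\delta_0$. For a finite signed Borel measure $\mu$ on $\mathbf R^d$ let $$\mathcal E(\mu)=\iint_{\{(x,y)\,:\,x\ne y\}} g(x-y)\,d\mu(x)\,d\mu(y),\qquad \|\mu\|_{BL}=\sup_{f\in W^{1,\infty}(\mathbf R^d)}\frac{\int f\,d\mu}{\|f\|_{W^{1,\infty}}},$$ where $\|f\|_{W^{1,\infty}}=\max\{\|f\|_{L^\infty},\|\nabla f\|_{L^\infty}\}$ and $f$ is represented by its continuous representative. The energy $\mathcal E(\mu)\in[-\infty,\infty]$ is said to be well defined if the positive and the negative part of the double integral are not both infinite. Let $K\subset\mathbf R^d$ be a compact set whose boundary is a $C^2$ hypersurface. Then there exist a compact set $K_2\supset K$ and a constant $k>0$, both depending only on $K$ (and on $d$), such that $$\|\mu|_{K_2}\|_{BL}^2\le k\,\mathcal E(\mu)$$ for every finite signed Borel measure $\mu$ on $\mathbf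 R^d$ (not necessarily of compact support) such that $\mu$ has no atoms, $\mathcal E(\mu)$ is well defined, $\mu(\mathbf R^d)=0$ if $d=2$, and $\mu$ has a definite sign outside $K$ (that is, $\mu$ is nonnegative on all Borel subsets of $\mathbf R^d\setminus K$, or nonpositive on all of them). -/

import Mathlib

open MeasureTheory Set
open scoped ENNReal ContDiff

noncomputable section

namespace CoulombBL

/-- Euclidean space `ℝ^d`. -/
abbrev Rd (d : ℕ) := EuclideanSpace ℝ (Fin d)

/-- The boundary of `K` is a `C²` hypersurface: near each of its points it is the zero set of a
`C²` function whose differential does not vanish there. The closure of every bounded open set with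
`C²` boundary is covered. -/
def HasC2Boundary {d : ℕ} (K : Set (Rd d)) : Prop :=
  ∀ x ∈ frontier K, ∃ U : Set (Rd d), IsOpen U ∧ x ∈ U ∧ ∃ φ : Rd d → ℝ,
    ContDiffOn ℝ 2 φ U ∧ fderiv ℝ φ x ≠ 0 ∧ frontier K ∩ U = {y ∈ U | φ y = 0}

/-- `G` is the weak (distributional) gradient of `f` on `ℝ^d`. -/
def HasWeakGradient {d : ℕ} (f : Rd d → ℝ) (G : Rd d → Rd d) : Prop :=
  LocallyIntegrable f volume ∧ LocallyIntegrable G volume ∧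
    ∀ φ : Rd d → ℝ, ContDiff ℝ ∞ φ → HasCompactSupport φ → ∀ v : Rd d,
      ∫ x, f x * fderiv ℝ φ x v = - ∫ x, inner ℝ (G x) v * φ x

/-- `max {‖f‖_{L^∞}, ‖∇f‖_{L^∞}}` for a function `f` with weak gradient `G`. -/
def normW1Inf {d : ℕ} (f : Rd d → ℝ) (G : Rd d → Rd d) : ℝ≥0∞ :=
  max (eLpNorm f ⊤ volume) (eLpNorm G ⊤ volume)

/-- The bounded Lipschitz norm: the supremum of `∫ f dμ / ‖f‖_{W^{1,∞}}` over `f ∈ W^{1,∞}(ℝ^d)`.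
A class in `W^{1,∞}(ℝ^d)` is integrated against `μ`, which need not be absolutely continuous,
through its continuous representative. (The set of `f` is symmetric, so that cutting negative
values of the integral off at `0` does not change the supremum; for `f = 0` the quotient is
`0 / 0 = 0`.) -/
def blNorm {d : ℕ} (μ : SignedMeasure (Rd d)) : ℝ≥0∞ :=
  ⨆ (f : Rd d → ℝ) (G : Rd d → Rd d)
    (_ : Continuous f ∧ HasWeakGradient f G ∧ normW1Inf f G < ⊤),
    ENNReal.ofReal (∫ᵛ x, f x ∂•μ) / normW1Inf f G

/-- The normalizing constant of the Coulomb kernel: `1 / (2π)` for `d = 2` and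
`1 / (d (d - 2) |B(0,1)|) = 1 / ((d - 2) |S^{d-1}|)` for `d ≥ 3`. -/
def coulombConst (d : ℕ) : ℝ :=
  if d = 2 then 1 / (2 * Real.pi)
  else 1 / ((d : ℝ) * ((d : ℝ) - 2) * volume.real (Metric.ball (0 : Rd d) 1))

/-- The Coulomb kernel, that is the fundamental solution of `-Δ`, in dimension `d ≥ 2`. -/
def coulombKernel (d : ℕ) (x : Rd d) : ℝ :=
  if d = 2 then -(coulombConst d * Real.log ‖x‖) else coulombConst d / ‖x‖ ^ (d - 2)

/-- The complement of the diagonal in `ℝ^d × ℝ^d`. -/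
def offDiag (d : ℕ) : Set (Rd d × Rd d) := {p | p.1 ≠ p.2}

/-- The integral of the positive part of `g(x - y) dμ(x) dμ(y)` off the diagonal, where
`μ = μ⁺ - μ⁻` is the Jordan decomposition. -/
def energyPos {d : ℕ} (μ : SignedMeasure (Rd d)) : ℝ≥0∞ :=
  let p := μ.toJordanDecomposition.posPart
  let n := μ.toJordanDecomposition.negPart
  (∫⁻ z in offDiag d, ENNReal.ofReal (coulombKernel d (z.1 - z.2)) ∂(p.prod p + n.prod n)) +
    ∫⁻ z in offDiag d, ENNReal.ofReal (-coulombKernel d (z.1 - z.2)) ∂(p.prod n + n.prod p)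

/-- The integral of the negative part of `g(x - y) dμ(x) dμ(y)` off the diagonal. -/
def energyNeg {d : ℕ} (μ : SignedMeasure (Rd d)) : ℝ≥0∞ :=
  let p := μ.toJordanDecomposition.posPart
  let n := μ.toJordanDecomposition.negPart
  (∫⁻ z in offDiag d, ENNReal.ofReal (-coulombKernel d (z.1 - z.2)) ∂(p.prod p + n.prod n)) +
    ∫⁻ z in offDiag d, ENNReal.ofReal (coulombKernel d (z.1 - z.2)) ∂(p.prod n + n.prod p)

/-- The double integral that defines the energy exists in `[-∞, ∞]`: it is not `∞ - ∞`. -/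
def EnergyDefined {d : ℕ} (μ : SignedMeasure (Rd d)) : Prop :=
  energyPos μ ≠ ⊤ ∨ energyNeg μ ≠ ⊤

/-- The Coulomb energy `∬_{x ≠ y} g(x - y) dμ(x) dμ(y)`, with values in `[-∞, ∞]`; to be used when
`EnergyDefined μ` holds. -/
def energy {d : ℕ} (μ : SignedMeasure (Rd d)) : EReal :=
  (energyPos μ : EReal) - (energyNeg μ : EReal)

end CoulombBL

end

namespace CoulombBL

open Filter Topology

/-! The Coulomb kernel is a positive superposition of Gaussians, `C ∫₀^∞ t^(d/2-2) exp(-t|x-y|²)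
dt`. For `d = 2` the term `exp(-t)` is subtracted in the integrand to make it converge, and
neutrality of `μ` cancels this correction. A Gaussian is, up to a constant, a convolution of two
Gaussians, so each Gaussian energy is a multiple of a squared L² norm, hence nonnegative. For each
`t` the positive part of the double integral is the negative part plus the Gaussian energy;
integrating this in `ℝ≥0∞` requires no finiteness (`exists_energy_identity`). A well defined Coulomb
energy is therefore `C * mixedEnergy`, possibly infinite (`exists_energy_eq`).

For a smooth compactly supported `φ`, formally `φ = g * (-Δφ)`, so Cauchy–Schwarz for the energy
bounds `(∫ φ dμ)²` by the energy times `∫ |∇φ|²`. This is carried out for each Gaussian and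
integrated over `t ∈ [1/r, r]`. The heat equation turns the potentials of `Δφ` into a difference of
Gaussian means, which tends to a multiple of `φ` as `r → ∞` (`exists_sq_integral_mul_le`).
Mollification extends the bound to a bounded Lipschitz function times a smooth cutoff
(`exists_abs_integral_mul_cutoff_le`).

It remains to replace the smooth cutoff by the indicator of `K₂`, a ball of radius `R + 1` where `K`
lies in the ball of radius `R`. The error is dominated by a smooth `η ≥ 0` that vanishes on the
smaller ball. Where `η` is nonzero `μ` has one sign, so the integral of `η` against `|μ|` is `|∫ η
dμ|`, again controlled by the energy (`exists_abs_setIntegral_le`). -/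

/-- The Gaussian kernel `exp (-t |x - y|²)`. -/
noncomputable def gaussKernel {d : ℕ} (t : ℝ) (x y : Rd d) : ℝ := Real.exp (-t * ‖x - y‖ ^ 2)

/-! ### Gaussian energies and their positivity -/

section Gauss

variable {d : ℕ} {t : ℝ}

lemma gaussKernel_pos (t : ℝ) (x y : Rd d) : 0 < gaussKernel t x y := Real.exp_pos _

lemma gaussKernel_le_one (ht : 0 ≤ t) (x y : Rd d) : gaussKernel t x y ≤ 1 := by
  rw [gaussKernel, Real.exp_le_one_iff]
  nlinarith [mul_nonneg ht (sq_nonneg ‖x - y‖)]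

lemma gaussKernel_comm (t : ℝ) (x y : Rd d) : gaussKernel t x y = gaussKernel t y x := by
  rw [gaussKernel, gaussKernel, norm_sub_rev]

lemma continuous_gaussKernel :
    Continuous fun p : ℝ × Rd d × Rd d => gaussKernel p.1 p.2.1 p.2.2 := by
  unfold gaussKernel
  fun_prop

@[fun_prop]
lemma continuous_gaussKernel_comp {X : Type*} [TopologicalSpace X] {s : X → ℝ} {f g : X → Rd d}
    (hs : Continuous s) (hf : Continuous f) (hg : Continuous g) :
    Continuous fun x => gaussKernel (s x) (f x) (g x) :=
  continuous_gaussKernel.comp (hs.prodMk (hf.prodMk hg))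

/-- The parallelogram law completes the square in `z` about the midpoint of `x` and `y`. -/
lemma gaussKernel_mul_gaussKernel (t : ℝ) (x y z : Rd d) :
    gaussKernel (2 * t) x z * gaussKernel (2 * t) y z =
      gaussKernel t x y * Real.exp (-(4 * t) * ‖z - (1 / 2 : ℝ) • (x + y)‖ ^ 2) := by
  unfold gaussKernel
  rw [← Real.exp_add, ← Real.exp_add]
  congr 1
  have h := parallelogram_law_with_norm ℝ (x - z) (y - z)
  have h1 : x - z - (y - z) = x - y := by abel
  have h2 : ‖x - z + (y - z)‖ = 2 * ‖z - (1 / 2 : ℝ) • (x + y)‖ := by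
    have : x - z + (y - z) = (-2 : ℝ) • (z - (1 / 2 : ℝ) • (x + y)) := by module
    rw [this, norm_smul]
    norm_num
  rw [h1, h2] at h
  linear_combination t * h

lemma integrable_gaussKernel (ht : 0 < t) (x : Rd d) : Integrable (gaussKernel t x) := by
  have h := GaussianFourier.integrable_cexp_neg_mul_sq_norm_add
    (V := Rd d) (b := (t : ℂ)) (by simpa using ht) 0 0
  have h2 : Integrable fun v : Rd d => Real.exp (-t * ‖v‖ ^ 2) := by
    refine h.norm.congr (Eventually.of_forall fun v => ?_)
    simp [Complex.norm_exp, ← Complex.ofReal_pow]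
  refine (h2.comp_sub_right x).congr (Eventually.of_forall fun v => ?_)
  simp [gaussKernel, norm_sub_rev]

/-- This semigroup property is the source of positive definiteness: it factors the Gaussian through
L². -/
lemma integral_gaussKernel_mul_gaussKernel (ht : 0 < t) (x y : Rd d) :
    ∫ z, gaussKernel (2 * t) x z * gaussKernel (2 * t) y z =
      (Real.pi / (4 * t)) ^ (d / 2 : ℝ) * gaussKernel t x y := by
  simp_rw [gaussKernel_mul_gaussKernel, integral_const_mul]
  rw [integral_sub_right_eq_self (fun z : Rd d => Real.exp (-(4 * t) * ‖z‖ ^ 2)),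
    GaussianFourier.integral_rexp_neg_mul_sq_norm (by positivity)]
  simp [mul_comm]

lemma integrable_gaussKernel_mul_gaussKernel (ht : 0 < t) (x y : Rd d) :
    Integrable fun z => gaussKernel (2 * t) x z * gaussKernel (2 * t) y z := by
  refine (integrable_gaussKernel (by positivity : 0 < 2 * t) x).mono'
    (by fun_prop) (Eventually.of_forall fun z => ?_)
  rw [Real.norm_of_nonneg (by have := gaussKernel_pos (2 * t) x z; have := gaussKernel_pos (2 * t) y z; positivity)]
  exact mul_le_of_le_one_right (gaussKernel_pos _ _ _).le (gaussKernel_le_one (by positivity) _ _)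

/-- The Gaussian energy of two measures with densities. -/
noncomputable def gaussEnergy (t : ℝ) (α β : Measure (Rd d)) (a b : Rd d → ℝ) : ℝ :=
  ∫ p, gaussKernel t p.1 p.2 * (a p.1 * b p.2) ∂(α.prod β)

/-- The Gaussian potential of a measure with a density. -/
noncomputable def gaussPotential (t : ℝ) (α : Measure (Rd d)) (a : Rd d → ℝ) (z : Rd d) : ℝ :=
  ∫ x, gaussKernel t x z * a x ∂α

variable {α β : Measure (Rd d)} {a b : Rd d → ℝ}

lemma integrable_gaussKernel_mul (ht : 0 ≤ t) (ha : Integrable a α) (hb : Integrable b β) :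
    Integrable (fun p : Rd d × Rd d => gaussKernel t p.1 p.2 * (a p.1 * b p.2)) (α.prod β) := by
  refine (ha.mul_prod hb).mono (by have := (ha.mul_prod hb).aestronglyMeasurable; fun_prop)
    (Eventually.of_forall fun p => ?_)
  rw [norm_mul, Real.norm_of_nonneg (gaussKernel_pos _ _ _).le]
  exact mul_le_of_le_one_left (norm_nonneg _) (gaussKernel_le_one ht _ _)

lemma integrable_gauss_triple (ht : 0 < t) (ha : Integrable a α) (hb : Integrable b β) :
    Integrable (fun q : (Rd d × Rd d) × Rd d =>
      (gaussKernel (2 * t) q.1.1 q.2 * gaussKernel (2 * t) q.1.2 q.2) * (a q.1.1 * b q.1.2))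
      ((α.prod β).prod volume) := by
  have hab := ha.mul_prod hb
  have hm : AEStronglyMeasurable (fun q : (Rd d × Rd d) × Rd d => a q.1.1 * b q.1.2)
      ((α.prod β).prod volume) := hab.aestronglyMeasurable.comp_fst
  rw [integrable_prod_iff (by fun_prop)]
  refine ⟨Eventually.of_forall fun p =>
    (integrable_gaussKernel_mul_gaussKernel ht p.1 p.2).mul_const (a p.1 * b p.2), ?_⟩
  have h := ((integrable_gaussKernel_mul ht.le ha hb).norm).const_mul
    ((Real.pi / (4 * t)) ^ (d / 2 : ℝ))
  refine h.congr (Eventually.of_forall fun p => ?_)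
  simp only [norm_mul, Real.norm_of_nonneg (gaussKernel_pos _ _ _).le, integral_mul_const]
  rw [integral_gaussKernel_mul_gaussKernel ht]
  ring

variable [SFinite α] [SFinite β]

lemma integral_gauss_triple (z : Rd d) :
    ∫ p : Rd d × Rd d, (gaussKernel (2 * t) p.1 z * gaussKernel (2 * t) p.2 z) * (a p.1 * b p.2)
      ∂(α.prod β) = gaussPotential (2 * t) α a z * gaussPotential (2 * t) β b z := by
  rw [gaussPotential, gaussPotential, ← integral_prod_mul]
  exact integral_congr_ae (Eventually.of_forall fun p => by ring)

lemma integrable_gaussPotential_mul (ht : 0 < t) (ha : Integrable a α) (hb : Integrable b β) :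
    Integrable fun z => gaussPotential (2 * t) α a z * gaussPotential (2 * t) β b z := by
  refine (integrable_gauss_triple ht ha hb).integral_prod_right.congr
    (Eventually.of_forall fun z => integral_gauss_triple z)

/-- Fubini and the semigroup property make the energy an L² inner product of potentials. -/
lemma integral_gaussPotential_mul (ht : 0 < t) (ha : Integrable a α) (hb : Integrable b β) :
    ∫ z, gaussPotential (2 * t) α a z * gaussPotential (2 * t) β b z =
      (Real.pi / (4 * t)) ^ (d / 2 : ℝ) * gaussEnergy t α β a b := by
  simp_rw [← integral_gauss_triple (α := α) (β := β)]
  rw [← integral_prod_symm _ (integrable_gauss_triple ht ha hb), gaussEnergy,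
    ← integral_const_mul, integral_prod _ (integrable_gauss_triple ht ha hb)]
  refine integral_congr_ae (Eventually.of_forall fun p => ?_)
  simp only [integral_mul_const]
  rw [integral_gaussKernel_mul_gaussKernel ht]
  ring

/-- The Gaussian energy is a positive semidefinite quadratic form. -/
lemma gaussEnergy_quadratic_nonneg (ht : 0 < t) (ha : Integrable a α) (hb : Integrable b β)
    (s : ℝ) :
    0 ≤ gaussEnergy t α α a a + 2 * s * gaussEnergy t α β a b + s ^ 2 * gaussEnergy t β β b b := by
  have hc : 0 < (Real.pi / (4 * t)) ^ (d / 2 : ℝ) := by positivity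
  refine nonneg_of_mul_nonneg_right ?_ hc
  have hexp : ∫ z, (gaussPotential (2 * t) α a z + s * gaussPotential (2 * t) β b z) ^ 2 =
      (Real.pi / (4 * t)) ^ (d / 2 : ℝ) * (gaussEnergy t α α a a +
        2 * s * gaussEnergy t α β a b + s ^ 2 * gaussEnergy t β β b b) := by
    have e : ∀ z, (gaussPotential (2 * t) α a z + s * gaussPotential (2 * t) β b z) ^ 2 =
        gaussPotential (2 * t) α a z * gaussPotential (2 * t) α a z +
        2 * s * (gaussPotential (2 * t) α a z * gaussPotential (2 * t) β b z) +
        s ^ 2 * (gaussPotential (2 * t) β b z * gaussPotential (2 * t) β b z) := fun z => by ring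
    have h1 := integrable_gaussPotential_mul ht ha ha
    have h2 := (integrable_gaussPotential_mul ht ha hb).const_mul (2 * s)
    have h3 := (integrable_gaussPotential_mul ht hb hb).const_mul (s ^ 2)
    have h12 : Integrable fun z =>
        gaussPotential (2 * t) α a z * gaussPotential (2 * t) α a z +
        2 * s * (gaussPotential (2 * t) α a z * gaussPotential (2 * t) β b z) := h1.add h2
    simp_rw [e]
    rw [integral_add h12 h3, integral_add h1 h2, integral_const_mul, integral_const_mul,
      integral_gaussPotential_mul ht ha ha, integral_gaussPotential_mul ht ha hb,
      integral_gaussPotential_mul ht hb hb]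
    ring
  rw [← hexp]
  exact integral_nonneg fun z => sq_nonneg _

lemma gaussEnergy_self_nonneg (ht : 0 < t) (ha : Integrable a α) : 0 ≤ gaussEnergy t α α a a := by
  simpa using gaussEnergy_quadratic_nonneg ht ha ha 0

/-- Cauchy–Schwarz in additive form: with `s` independent of `t`, it can be integrated in `t` before
optimizing. -/
lemma two_mul_abs_gaussEnergy_le (ht : 0 < t) (ha : Integrable a α) (hb : Integrable b β)
    {s : ℝ} (hs : 0 < s) :
    2 * |gaussEnergy t α β a b| ≤ s * gaussEnergy t α α a a + s⁻¹ * gaussEnergy t β β b b := by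
  have h1 := gaussEnergy_quadratic_nonneg ht ha hb (s⁻¹)
  have h2 := gaussEnergy_quadratic_nonneg ht ha hb (-s⁻¹)
  have e : s * s⁻¹ = 1 := mul_inv_cancel₀ hs.ne'
  have h1' := mul_nonneg hs.le h1
  have h2' := mul_nonneg hs.le h2
  have e1 : s * (s⁻¹ ^ 2) = s⁻¹ := by field_simp
  rcases abs_cases (gaussEnergy t α β a b) with ⟨h, _⟩ | ⟨h, _⟩ <;> rw [h]
  · linear_combination h2' - 2 * gaussEnergy t α β a b * e + gaussEnergy t β β b b * e1
  · linear_combination h1' + 2 * gaussEnergy t α β a b * e + gaussEnergy t β β b b * e1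

end Gauss

/-! ### The Coulomb kernel as a mixture of Gaussians -/

/-- The Gaussian kernel, renormalized in dimension two by subtracting its value at distance one. -/
noncomputable def renormGauss {d : ℕ} (t : ℝ) (x y : Rd d) : ℝ :=
  gaussKernel t x y - if d = 2 then Real.exp (-t) else 0

/-- The inequality `1 - exp(-u) ≤ u` absorbs the singularity `1/t` at the origin. -/
lemma abs_inv_mul_exp_sub_exp_le {a b t : ℝ} (ht : 0 < t) (hab : a ≤ b) :
    |t⁻¹ * (Real.exp (-(a * t)) - Real.exp (-(b * t)))| ≤ (b - a) * Real.exp (-(a * t)) := by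
  have h1 : Real.exp (-(b * t)) ≤ Real.exp (-(a * t)) := by
    apply Real.exp_le_exp.2
    nlinarith
  rw [abs_of_nonneg (mul_nonneg (inv_nonneg.2 ht.le) (sub_nonneg.2 h1)), inv_mul_le_iff₀ ht]
  have h2 : Real.exp (-(b * t)) = Real.exp (-(a * t)) * Real.exp (-((b - a) * t)) := by
    rw [← Real.exp_add]
    ring_nf
  have h3 := Real.add_one_le_exp (-((b - a) * t))
  have h4 := Real.exp_pos (-(a * t))
  rw [h2]
  nlinarith

lemma integrableOn_inv_mul_exp_sub_exp {a b : ℝ} (ha : 0 < a) (hb : 0 < b) :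
    IntegrableOn (fun t : ℝ => t⁻¹ * (Real.exp (-(a * t)) - Real.exp (-(b * t)))) (Ioi 0) := by
  wlog hab : a ≤ b generalizing a b
  · refine (this hb ha (le_of_not_ge hab)).neg.congr (Eventually.of_forall fun t => ?_)
    simp only [Pi.neg_apply]
    ring
  have h : IntegrableOn (fun t : ℝ => (b - a) * Real.exp (-(a * t))) (Ioi 0) := by
    simpa [IntegrableOn] using (integrableOn_exp_mul_Ioi (neg_neg_of_pos ha) 0).const_mul (b - a)
  refine Integrable.mono' h (by fun_prop) ?_
  filter_upwards [ae_restrict_mem measurableSet_Ioi] with t ht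
  exact abs_inv_mul_exp_sub_exp_le ht hab

lemma integral_inv_mul_exp_sub_exp {a b : ℝ} (ha : 0 < a) (hb : 0 < b) :
    ∫ t in Ioi (0 : ℝ), t⁻¹ * (Real.exp (-(a * t)) - Real.exp (-(b * t))) = Real.log (b / a) := by
  have hf : Continuous fun x : ℝ => Real.exp (-x) := by fun_prop
  have h := Frullani.integral_Ioi_eq (f := fun x : ℝ => Real.exp (-x)) (L := 1) (R := 0)
    (hf.locallyIntegrable.locallyIntegrableOn _) ha hb
    ((hf.tendsto' 0 1 (by simp)).mono_left nhdsWithin_le_nhds)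
    (Real.tendsto_exp_neg_atTop_nhds_zero)
    (by simpa using integrableOn_inv_mul_exp_sub_exp ha hb)
  simpa using h

lemma coulombConst_pos {d : ℕ} (hd : 2 ≤ d) : 0 < coulombConst d := by
  unfold coulombConst
  split_ifs with h
  · positivity
  · have h3 : (2 : ℝ) < d := by exact_mod_cast lt_of_le_of_ne hd (Ne.symm h)
    have hv : 0 < volume.real (Metric.ball (0 : Rd d) 1) :=
      ENNReal.toReal_pos (Metric.measure_ball_pos _ _ one_pos).ne' measure_ball_lt_top.ne
    have : 0 < (d : ℝ) - 2 := by linarith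
    positivity

/-- The Coulomb kernel is a positive mixture of renormalized Gaussians, whose sign at a given pair
of points does not depend on the variance. -/
lemma exists_coulombKernel_eq_integral {d : ℕ} (hd : 2 ≤ d) :
    ∃ C : ℝ, 0 < C ∧ ∀ x y : Rd d, x ≠ y →
      IntegrableOn (fun t : ℝ => t ^ (d / 2 - 2 : ℝ) * renormGauss t x y) (Ioi 0) ∧
      coulombKernel d (x - y) =
        C * ∫ t in Ioi (0 : ℝ), t ^ (d / 2 - 2 : ℝ) * renormGauss t x y ∧
      ((∀ t > 0, 0 ≤ renormGauss t x y) ∨ ∀ t > 0, renormGauss t x y ≤ 0) := by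
  have hc := coulombConst_pos hd
  by_cases h2 : d = 2
  · subst h2
    -- Frullani's integral gives `log (1/|x-y|²) = -2 log |x-y|`, whence the factor `1/2`.
    refine ⟨coulombConst 2 / 2, by positivity, fun x y hxy => ?_⟩
    have hr : 0 < ‖x - y‖ := norm_pos_iff.2 (sub_ne_zero.2 hxy)
    have e : EqOn (fun t : ℝ => t⁻¹ * (Real.exp (-(‖x - y‖ ^ 2 * t)) - Real.exp (-(1 * t))))
        (fun t : ℝ => t ^ ((2 : ℕ) / 2 - 2 : ℝ) * renormGauss t x y) (Ioi 0) := by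
      intro t ht
      have : ((2 : ℕ) / 2 - 2 : ℝ) = -1 := by norm_num
      simp only [renormGauss, gaussKernel, if_true, one_mul, this, Real.rpow_neg_one]
      ring_nf
    refine ⟨(integrableOn_inv_mul_exp_sub_exp (by positivity) one_pos).congr_fun e
      measurableSet_Ioi, ?_, ?_⟩
    · rw [← setIntegral_congr_fun measurableSet_Ioi e,
        integral_inv_mul_exp_sub_exp (by positivity) one_pos, one_div, Real.log_inv, Real.log_pow]
      simp [coulombKernel]
      ring
    · simp only [renormGauss, gaussKernel, if_true, sub_nonneg, sub_nonpos, Real.exp_le_exp]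
      rcases le_total ‖x - y‖ 1 with h | h
      · refine Or.inl fun t ht => ?_
        nlinarith [pow_le_one₀ hr.le h (n := 2)]
      · refine Or.inr fun t ht => ?_
        nlinarith [one_le_pow₀ h (n := 2)]
  · have h3 : (2 : ℝ) < d := by exact_mod_cast lt_of_le_of_ne hd (Ne.symm h2)
    have ha : 0 < (d / 2 - 1 : ℝ) := by linarith
    have hG := Real.Gamma_pos_of_pos ha
    refine ⟨coulombConst d / Real.Gamma (d / 2 - 1), by positivity, fun x y hxy => ?_⟩
    have hr : 0 < ‖x - y‖ := norm_pos_iff.2 (sub_ne_zero.2 hxy)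
    have e : ∀ t : ℝ, t ^ (d / 2 - 2 : ℝ) * renormGauss t x y =
        t ^ ((d / 2 - 1 : ℝ) - 1) * Real.exp (-(‖x - y‖ ^ 2 * t)) := by
      intro t
      simp only [renormGauss, gaussKernel, h2, if_false, sub_zero]
      ring_nf
    have hint : ∫ t in Ioi (0 : ℝ), t ^ (d / 2 - 2 : ℝ) * renormGauss t x y =
        (1 / ‖x - y‖ ^ 2) ^ (d / 2 - 1 : ℝ) * Real.Gamma (d / 2 - 1) := by
      simp_rw [e]
      exact Real.integral_rpow_mul_exp_neg_mul_Ioi ha (by positivity)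
    refine ⟨?_, ?_, Or.inl fun t ht => ?_⟩
    -- A non-integrable function has integral `0` by convention, while the value just computed is
    -- positive.
    · refine of_not_not fun hn => ?_
      have := integral_undef hn
      rw [hint] at this
      have h0 : 0 < (1 / ‖x - y‖ ^ 2) ^ (d / 2 - 1 : ℝ) * Real.Gamma (d / 2 - 1) := by positivity
      exact h0.ne' this
    · rw [hint]
      have : (1 / ‖x - y‖ ^ 2) ^ (d / 2 - 1 : ℝ) = 1 / ‖x - y‖ ^ (d - 2) := by
        rw [Real.div_rpow zero_le_one (by positivity), Real.one_rpow, ← Real.rpow_natCast,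
          ← Real.rpow_mul hr.le, ← Real.rpow_natCast, Nat.cast_sub hd]
        congr 2
        push_cast
        ring
      rw [this, coulombKernel, if_neg h2, ← mul_assoc, mul_right_comm, div_mul_cancel₀ _ hG.ne', mul_one_div]
    · simp only [renormGauss, h2, if_false, sub_zero]
      exact (gaussKernel_pos _ _ _).le

/-- Taking positive parts commutes with the `t`-integral only because the integrand keeps one sign
in `t`. -/
lemma ofReal_mul_integral_eq {C s : ℝ} (hC : 0 < C) {f : ℝ → ℝ} (hf : IntegrableOn f (Ioi 0))
    (hs : (∀ t > 0, 0 ≤ f t * s) ∨ ∀ t > 0, f t * s ≤ 0) :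
    ENNReal.ofReal ((C * ∫ t in Ioi 0, f t) * s) =
      ENNReal.ofReal C * ∫⁻ t in Ioi 0, ENNReal.ofReal (f t * s) := by
  have e : (C * ∫ t in Ioi 0, f t) * s = C * ∫ t in Ioi 0, f t * s := by
    rw [integral_mul_const]
    ring
  rw [e, ENNReal.ofReal_mul hC.le]
  congr 1
  rcases hs with h | h
  · refine ofReal_integral_eq_lintegral_ofReal (hf.mul_const s) ?_
    filter_upwards [ae_restrict_mem measurableSet_Ioi] with t ht using h t ht
  · rw [ENNReal.ofReal_of_nonpos (setIntegral_nonpos measurableSet_Ioi h),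
      setLIntegral_congr_fun measurableSet_Ioi (fun t ht => ENNReal.ofReal_of_nonpos (h t ht)),
      lintegral_zero]

/-! ### The energy identity for a measure with a density -/

section Energy

variable {d : ℕ} {α : Measure (Rd d)} [IsFiniteMeasure α]

lemma continuous_renormGauss_comp {X : Type*} [TopologicalSpace X] {s : X → ℝ} {f g : X → Rd d}
    (hs : Continuous s) (hf : Continuous f) (hg : Continuous g) :
    Continuous fun x => renormGauss (s x) (f x) (g x) := by
  unfold renormGauss
  split_ifs <;> fun_prop

lemma measurableSet_offDiag : MeasurableSet (offDiag d) :=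
  (isClosed_eq continuous_fst continuous_snd).isOpen_compl.measurableSet

/-- The slices of the diagonal are singletons, so without atoms the diagonal is null and Gaussian
integrals may run over the whole product. -/
lemma ae_prod_mem_offDiag (hα : ∀ x, α {x} = 0) : ∀ᵐ p ∂(α.prod α), p ∈ offDiag d := by
  have hm : MeasurableSet (offDiag d)ᶜ := measurableSet_offDiag.compl
  rw [ae_iff]
  change (α.prod α) (offDiag d)ᶜ = 0
  rw [Measure.measure_prod_null hm]
  refine Eventually.of_forall fun x => ?_
  have : Prod.mk x ⁻¹' (offDiag d)ᶜ = {x} := by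
    ext y
    simp [offDiag, eq_comm]
  simp [this, hα]

lemma measurable_rpow_mul_renormGauss :
    Measurable fun q : (Rd d × Rd d) × ℝ =>
      q.2 ^ (d / 2 - 2 : ℝ) * renormGauss q.2 q.1.1 q.1.2 := by
  have h := (continuous_renormGauss_comp (d := d) (X := (Rd d × Rd d) × ℝ) continuous_snd
    (continuous_fst.comp continuous_fst) (continuous_snd.comp continuous_fst)).measurable
  exact (measurable_snd.pow_const _).mul h

/-- Tonelli for the mixture of Gaussians that represents the Coulomb kernel. -/
lemma exists_setLIntegral_coulombKernel_eq (hd : 2 ≤ d) :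
    ∃ C : ℝ, 0 < C ∧ ∀ (α : Measure (Rd d)) [IsFiniteMeasure α], (∀ x, α {x} = 0) →
      ∀ τ : Rd d × Rd d → ℝ, Measurable τ →
      ∫⁻ p in offDiag d, ENNReal.ofReal (coulombKernel d (p.1 - p.2) * τ p) ∂(α.prod α) =
        ENNReal.ofReal C * ∫⁻ t in Ioi (0 : ℝ), ∫⁻ p,
          ENNReal.ofReal (t ^ (d / 2 - 2 : ℝ) * renormGauss t p.1 p.2 * τ p) ∂(α.prod α) := by
  obtain ⟨C, hC, h⟩ := exists_coulombKernel_eq_integral hd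
  refine ⟨C, hC, fun α _ hα τ hτ => ?_⟩
  have hmeas : Measurable fun q : (Rd d × Rd d) × ℝ => ENNReal.ofReal
      (q.2 ^ (d / 2 - 2 : ℝ) * renormGauss q.2 q.1.1 q.1.2 * τ q.1) :=
    (measurable_rpow_mul_renormGauss.mul (hτ.comp measurable_fst)).ennreal_ofReal
  rw [Measure.restrict_eq_self_of_ae_mem (ae_prod_mem_offDiag hα),
    ← lintegral_lintegral_swap hmeas.aemeasurable, ← lintegral_const_mul _ hmeas.lintegral_prod_right']
  refine lintegral_congr_ae ?_
  filter_upwards [ae_prod_mem_offDiag hα] with p hp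
  obtain ⟨hi, he, hs⟩ := h p.1 p.2 hp
  rw [he]
  refine ofReal_mul_integral_eq hC hi ?_
  have hw : ∀ t : ℝ, 0 < t → 0 < t ^ (d / 2 - 2 : ℝ) := fun t ht => Real.rpow_pos_of_pos ht _
  rcases hs with hs | hs <;> rcases le_total 0 (τ p) with ht | ht
  · exact Or.inl fun t h0 => mul_nonneg (mul_nonneg (hw t h0).le (hs t h0)) ht
  · exact Or.inr fun t h0 => mul_nonpos_of_nonneg_of_nonpos
      (mul_nonneg (hw t h0).le (hs t h0)) ht
  · exact Or.inr fun t h0 => mul_nonpos_of_nonpos_of_nonneg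
      (mul_nonpos_of_nonneg_of_nonpos (hw t h0).le (hs t h0)) ht
  · exact Or.inl fun t h0 => mul_nonneg_of_nonpos_of_nonpos
      (mul_nonpos_of_nonneg_of_nonpos (hw t h0).le (hs t h0)) ht

/-- The formula `∫ F = ∫ F⁺ - ∫ F⁻` is written without subtraction so that it can be integrated in
`t` even when the totals are infinite. -/
lemma lintegral_ofReal_eq_add {X : Type*} [MeasurableSpace X] {κ : Measure X} {F : X → ℝ}
    (hF : Integrable F κ) (h0 : 0 ≤ ∫ x, F x ∂κ) :
    ∫⁻ x, ENNReal.ofReal (F x) ∂κ =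
      ∫⁻ x, ENNReal.ofReal (-F x) ∂κ + ENNReal.ofReal (∫ x, F x ∂κ) := by
  have h1 : ∫⁻ x, ENNReal.ofReal (F x) ∂κ ≠ ⊤ := hF.lintegral_lt_top.ne
  have h2 : ∫⁻ x, ENNReal.ofReal (-F x) ∂κ ≠ ⊤ := hF.neg.lintegral_lt_top.ne
  have h := integral_eq_lintegral_pos_part_sub_lintegral_neg_part hF
  rw [← ENNReal.toReal_eq_toReal_iff' h1 (by finiteness), ENNReal.toReal_add h2 (by finiteness),
    ENNReal.toReal_ofReal h0, h]
  ring

/-- In dimension two the correction contributes `exp(-t) (∫ σ dα)²`, which vanishes by neutrality.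
-/
lemma integral_renormGauss_mul {σ : Rd d → ℝ} (hσ : Integrable σ α)
    (h2 : d = 2 → ∫ x, σ x ∂α = 0) {t : ℝ} (ht : 0 ≤ t) :
    Integrable (fun p : Rd d × Rd d => renormGauss t p.1 p.2 * (σ p.1 * σ p.2)) (α.prod α) ∧
    ∫ p, renormGauss t p.1 p.2 * (σ p.1 * σ p.2) ∂(α.prod α) = gaussEnergy t α α σ σ := by
  have h := integrable_gaussKernel_mul ht hσ hσ
  have h' := (hσ.mul_prod hσ).const_mul (if d = 2 then Real.exp (-t) else 0)
  simp only [renormGauss, sub_mul]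
  refine ⟨h.sub h', ?_⟩
  rw [integral_sub h h', integral_const_mul, integral_prod_mul, gaussEnergy]
  split_ifs with hd
  · simp [h2 hd]
  · simp

/-- The energy identity: the positive part of the Coulomb energy is the negative part plus a
superposition of Gaussian energies, whether these are finite or not. -/
lemma exists_energy_identity (hd : 2 ≤ d) :
    ∃ C : ℝ, 0 < C ∧ ∀ (α : Measure (Rd d)) [IsFiniteMeasure α], (∀ x, α {x} = 0) →
      ∀ σ : Rd d → ℝ, Measurable σ → Integrable σ α → (d = 2 → ∫ x, σ x ∂α = 0) →
      ∫⁻ p in offDiag d, ENNReal.ofReal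
          (coulombKernel d (p.1 - p.2) * (σ p.1 * σ p.2)) ∂(α.prod α) =
        ∫⁻ p in offDiag d, ENNReal.ofReal
          (coulombKernel d (p.1 - p.2) * -(σ p.1 * σ p.2)) ∂(α.prod α) +
        ENNReal.ofReal C * ∫⁻ t in Ioi (0 : ℝ),
          ENNReal.ofReal (t ^ (d / 2 - 2 : ℝ) * gaussEnergy t α α σ σ) := by
  obtain ⟨C, hC, h⟩ := exists_setLIntegral_coulombKernel_eq hd
  refine ⟨C, hC, fun α _ hα σ hσm hσ h2 => ?_⟩
  have hτ : Measurable fun p : Rd d × Rd d => σ p.1 * σ p.2 := by fun_prop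
  rw [h α hα _ hτ, h α hα (fun p => -(σ p.1 * σ p.2)) hτ.neg, ← mul_add, ← lintegral_add_left]
  · congr 1
    refine setLIntegral_congr_fun measurableSet_Ioi fun t (ht : 0 < t) => ?_
    obtain ⟨hi, he⟩ := integral_renormGauss_mul hσ h2 ht.le
    have hw := Real.rpow_pos_of_pos ht (d / 2 - 2 : ℝ)
    have hI : ∫ p, t ^ (d / 2 - 2 : ℝ) * (renormGauss t p.1 p.2 * (σ p.1 * σ p.2)) ∂(α.prod α) =
        t ^ (d / 2 - 2 : ℝ) * gaussEnergy t α α σ σ := by rw [integral_const_mul, he]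
    have := lintegral_ofReal_eq_add (hi.const_mul (t ^ (d / 2 - 2 : ℝ)))
      (by rw [hI]; exact mul_nonneg hw.le (gaussEnergy_self_nonneg ht hσ))
    rw [hI] at this
    simpa only [mul_assoc, mul_neg] using this
  · have hmeas : Measurable fun q : (Rd d × Rd d) × ℝ => ENNReal.ofReal
        (q.2 ^ (d / 2 - 2 : ℝ) * renormGauss q.2 q.1.1 q.1.2 * -(σ q.1.1 * σ q.1.2)) :=
      (measurable_rpow_mul_renormGauss.mul (hτ.neg.comp measurable_fst)).ennreal_ofReal
    exact hmeas.lintegral_prod_left'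

end Energy

/-! ### Signed measures as a sign times the total variation -/

section Sign

variable {X : Type*} [MeasurableSpace X] {μ : SignedMeasure X}

/-- A measurable density of modulus one of a signed measure with respect to its total variation. -/
structure IsSign (μ : SignedMeasure X) (σ : X → ℝ) : Prop where
  measurable : Measurable σ
  abs_eq_one : ∀ x, |σ x| = 1
  posPart : ∀ᵐ x ∂μ.toJordanDecomposition.posPart, σ x = 1
  negPart : ∀ᵐ x ∂μ.toJordanDecomposition.negPart, σ x = -1

lemma exists_isSign (μ : SignedMeasure X) : ∃ σ : X → ℝ, IsSign μ σ := by
  classical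
  obtain ⟨S, hS, -, -, h1, h2⟩ := μ.toJordanDecomposition.exists_compl_positive_negative
  refine ⟨S.piecewise (fun _ => -1) fun _ => 1, ?_, fun x => ?_, ?_, ?_⟩
  · exact Measurable.piecewise hS measurable_const measurable_const
  · by_cases hx : x ∈ S <;> simp [hx]
  · filter_upwards [measure_eq_zero_iff_ae_notMem.1 h1] with x hx
    simp [hx]
  · filter_upwards [measure_eq_zero_iff_ae_notMem.1 h2] with x hx
    simp only [mem_compl_iff, not_not] at hx
    simp [hx]

instance (μ : SignedMeasure X) : IsFiniteMeasure μ.totalVariation := by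
  unfold SignedMeasure.totalVariation
  infer_instance

variable {σ : X → ℝ} (hσ : IsSign μ σ)
include hσ

lemma IsSign.integrable : Integrable σ μ.totalVariation :=
  (integrable_const (1 : ℝ)).mono' hσ.measurable.aestronglyMeasurable
    (Eventually.of_forall fun x => (hσ.abs_eq_one x).le)

lemma IsSign.setIntegral_mul {A : Set X} {f : X → ℝ}
    (hf : Integrable f μ.totalVariation) :
    ∫ x in A, f x * σ x ∂μ.totalVariation =
      ∫ x in A, f x ∂μ.toJordanDecomposition.posPart -
        ∫ x in A, f x ∂μ.toJordanDecomposition.negPart := by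
  have hfσ : Integrable (fun x => f x * σ x) μ.totalVariation :=
    hf.mono (hf.1.mul hσ.measurable.aestronglyMeasurable)
      (Eventually.of_forall fun x => by simp [hσ.abs_eq_one])
  unfold SignedMeasure.totalVariation at hfσ ⊢
  rw [integrable_add_measure] at hfσ
  rw [Measure.restrict_add, integral_add_measure hfσ.1.integrableOn hfσ.2.integrableOn,
    sub_eq_add_neg, ← integral_neg]
  congr 1 <;> refine integral_congr_ae ?_
  · filter_upwards [ae_restrict_of_ae hσ.posPart] with x hx
    simp [hx]
  · filter_upwards [ae_restrict_of_ae hσ.negPart] with x hx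
    simp [hx]

lemma IsSign.setIntegral_eq {A : Set X} (hA : MeasurableSet A) :
    ∫ x in A, σ x ∂μ.totalVariation = μ A := by
  have := hσ.setIntegral_mul (A := A) (integrable_const (1 : ℝ))
  simp only [one_mul] at this
  rw [this, μ.apply_eq_posPart_real_sub_negPart_real hA]
  simp [measureReal_def]

/-- Translates the vector-measure integral in `blNorm` into a Bochner integral, through the Jordan
decomposition. -/
lemma IsSign.integral_restrict {A : Set X} (hA : MeasurableSet A) {f : X → ℝ}
    (hf : Integrable f μ.totalVariation) :
    ∫ᵛ x, f x ∂•(μ.restrict A) = ∫ x in A, f x * σ x ∂μ.totalVariation := by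
  rw [hσ.setIntegral_mul (A := A) hf]
  have e : μ.restrict A = (μ.toJordanDecomposition.posPart.restrict A).toSignedMeasure -
      (μ.toJordanDecomposition.negPart.restrict A).toSignedMeasure := by
    ext B hB
    rw [VectorMeasure.restrict_apply _ hA hB,
      μ.apply_eq_posPart_real_sub_negPart_real (hB.inter hA), _root_.sub_apply,
      Measure.toSignedMeasure_apply_measurable hB, Measure.toSignedMeasure_apply_measurable hB,
      measureReal_restrict_apply hB, measureReal_restrict_apply hB]
  unfold SignedMeasure.totalVariation at hf
  rw [integrable_add_measure] at hf
  rw [e, VectorMeasure.integral_sub_vectorMeasure]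
  · have hflip : (ContinuousLinearMap.lsmul ℝ ℝ : ℝ →L[ℝ] ℝ →L[ℝ] ℝ) =
        (ContinuousLinearMap.lsmul ℝ ℝ).flip := by
      ext
      simp
    rw [hflip, VectorMeasure.integral_toSignedMeasure, VectorMeasure.integral_toSignedMeasure]
  · rw [VectorMeasure.Integrable, Measure.variation_toSignedMeasure]
    exact hf.1.integrableOn
  · rw [VectorMeasure.Integrable, Measure.variation_toSignedMeasure]
    exact hf.2.integrableOn

/-- On the part of the complement where `σ = -1`, `μ` is minus its total variation; nonnegativity
makes that part null. -/
lemma IsSign.ae_eq_one {K : Set X} (hK : MeasurableSet K)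
    (h : ∀ A, MeasurableSet A → A ⊆ Kᶜ → 0 ≤ μ A) :
    ∀ᵐ x ∂μ.totalVariation, x ∉ K → σ x = 1 := by
  have hm : MeasurableSet {x | x ∉ K ∧ σ x = -1} :=
    hK.compl.inter (hσ.measurable (measurableSet_singleton (-1)))
  have h0 := h {x | x ∉ K ∧ σ x = -1} hm fun x hx => hx.1
  rw [← hσ.setIntegral_eq hm, setIntegral_congr_fun hm fun x hx => hx.2] at h0
  simp only [integral_const, measureReal_restrict_apply_univ, smul_eq_mul, mul_neg, mul_one,
    Left.nonneg_neg_iff] at h0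
  have h1 : μ.totalVariation {x | x ∉ K ∧ σ x = -1} = 0 := by
    rw [← measureReal_eq_zero_iff]
    exact le_antisymm h0 measureReal_nonneg
  filter_upwards [measure_eq_zero_iff_ae_notMem.1 h1] with x hx hxK
  rcases eq_or_eq_neg_of_abs_eq (hσ.abs_eq_one x) with h | h
  · exact h
  · exact absurd ⟨hxK, h⟩ hx

lemma IsSign.ae_eq_neg_one {K : Set X} (hK : MeasurableSet K)
    (h : ∀ A, MeasurableSet A → A ⊆ Kᶜ → μ A ≤ 0) :
    ∀ᵐ x ∂μ.totalVariation, x ∉ K → σ x = -1 := by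
  have hm : MeasurableSet {x | x ∉ K ∧ σ x = 1} :=
    hK.compl.inter (hσ.measurable (measurableSet_singleton 1))
  have h0 := h {x | x ∉ K ∧ σ x = 1} hm fun x hx => hx.1
  rw [← hσ.setIntegral_eq hm, setIntegral_congr_fun hm fun x hx => hx.2] at h0
  simp only [integral_const, measureReal_restrict_apply_univ, smul_eq_mul, mul_one] at h0
  have h1 : μ.totalVariation {x | x ∉ K ∧ σ x = 1} = 0 := by
    rw [← measureReal_eq_zero_iff]
    exact le_antisymm h0 measureReal_nonneg
  filter_upwards [measure_eq_zero_iff_ae_notMem.1 h1] with x hx hxK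
  rcases eq_or_eq_neg_of_abs_eq (hσ.abs_eq_one x) with h | h
  · exact absurd ⟨hxK, h⟩ hx
  · exact h

lemma IsSign.totalVariation_singleton_eq_zero [MeasurableSingletonClass X] {x : X}
    (h : μ {x} = 0) : μ.totalVariation {x} = 0 := by
  rw [← hσ.setIntegral_eq (measurableSet_singleton x),
    setIntegral_congr_fun (g := fun _ => σ x) (measurableSet_singleton x)
      (fun y hy => by rw [mem_singleton_iff.1 hy])] at h
  simp only [integral_const, measureReal_restrict_apply_univ, smul_eq_mul, mul_eq_zero] at h
  rcases h with h | h
  · exact (measureReal_eq_zero_iff).1 h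
  · have := hσ.abs_eq_one x
    rw [h] at this
    simp at this

/-- The integral of a product over the square of the total variation, in terms of the Jordan
decomposition. -/
lemma IsSign.setLIntegral_prod {A : Set (X × X)} (f : X × X → ℝ) :
    ∫⁻ p in A, ENNReal.ofReal (f p * (σ p.1 * σ p.2))
        ∂(μ.totalVariation.prod μ.totalVariation) =
      ∫⁻ p in A, ENNReal.ofReal (f p)
        ∂(μ.toJordanDecomposition.posPart.prod μ.toJordanDecomposition.posPart +
          μ.toJordanDecomposition.negPart.prod μ.toJordanDecomposition.negPart) +
      ∫⁻ p in A, ENNReal.ofReal (-f p)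
        ∂(μ.toJordanDecomposition.posPart.prod μ.toJordanDecomposition.negPart +
          μ.toJordanDecomposition.negPart.prod μ.toJordanDecomposition.posPart) := by
  have key : ∀ (α β : Measure X) [SFinite α] [SFinite β] (a b : ℝ), (∀ᵐ x ∂α, σ x = a) →
      (∀ᵐ x ∂β, σ x = b) → ∫⁻ p in A, ENNReal.ofReal (f p * (σ p.1 * σ p.2)) ∂(α.prod β) =
        ∫⁻ p in A, ENNReal.ofReal (f p * (a * b)) ∂(α.prod β) := by
    intro α β _ _ a b ha hb
    refine lintegral_congr_ae (ae_restrict_of_ae ?_)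
    filter_upwards [Measure.quasiMeasurePreserving_fst.ae ha,
      Measure.quasiMeasurePreserving_snd.ae hb] with p h1 h2
    rw [h1, h2]
  unfold SignedMeasure.totalVariation
  simp only [Measure.prod_add, Measure.add_prod, Measure.restrict_add, lintegral_add_measure]
  rw [key _ _ _ _ hσ.posPart hσ.posPart, key _ _ _ _ hσ.posPart hσ.negPart,
    key _ _ _ _ hσ.negPart hσ.posPart, key _ _ _ _ hσ.negPart hσ.negPart]
  simp only [mul_one, mul_neg, neg_neg]
  abel

end Sign

/-! ### The Coulomb energy of a signed measure -/

section Energy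

variable {d : ℕ} {μ : SignedMeasure (Rd d)} {σ : Rd d → ℝ}

lemma energyPos_eq (hσ : IsSign μ σ) :
    energyPos μ = ∫⁻ p in offDiag d, ENNReal.ofReal (coulombKernel d (p.1 - p.2) *
      (σ p.1 * σ p.2)) ∂(μ.totalVariation.prod μ.totalVariation) := by
  rw [hσ.setLIntegral_prod fun p => coulombKernel d (p.1 - p.2)]
  rfl

lemma energyNeg_eq (hσ : IsSign μ σ) :
    energyNeg μ = ∫⁻ p in offDiag d, ENNReal.ofReal (coulombKernel d (p.1 - p.2) *
      -(σ p.1 * σ p.2)) ∂(μ.totalVariation.prod μ.totalVariation) := by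
  have := hσ.setLIntegral_prod (A := offDiag d) fun p => -coulombKernel d (p.1 - p.2)
  simp only [neg_neg] at this
  simp only [mul_neg, neg_mul] at this ⊢
  rw [this]
  rfl

/-- A well defined Coulomb energy is a superposition of Gaussian energies. -/
lemma exists_energy_eq (hd : 2 ≤ d) :
    ∃ C : ℝ, 0 < C ∧ ∀ (μ : SignedMeasure (Rd d)) (σ : Rd d → ℝ), IsSign μ σ →
      (∀ x, μ {x} = 0) → (d = 2 → μ univ = 0) → EnergyDefined μ →
      energy μ = ((ENNReal.ofReal C * ∫⁻ t in Ioi (0 : ℝ), ENNReal.ofReal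
        (t ^ (d / 2 - 2 : ℝ) * gaussEnergy t μ.totalVariation μ.totalVariation σ σ) : ℝ≥0∞) :
          EReal) := by
  obtain ⟨C, hC, h⟩ := exists_energy_identity hd
  refine ⟨C, hC, fun μ σ hσ hat h2 hdef => ?_⟩
  have := h μ.totalVariation (fun x => hσ.totalVariation_singleton_eq_zero (hat x)) σ
    hσ.measurable hσ.integrable fun hd2 => by
      rw [← setIntegral_univ, hσ.setIntegral_eq MeasurableSet.univ, h2 hd2]
  rw [← energyPos_eq hσ, ← energyNeg_eq hσ] at this
  -- By the identity, an infinite negative part forces an infinite positive part, which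
  -- well-definedness excludes.
  have hneg : energyNeg μ ≠ ⊤ := by
    rcases hdef with hp | hn
    · intro hn
      rw [this, hn, top_add] at hp
      exact hp rfl
    · exact hn
  rw [energy, this, EReal.coe_ennreal_add, add_comm]
  lift energyNeg μ to NNReal using hneg with N
  exact EReal.add_sub_cancel_right

end Energy

/-! ### Exchanging the integrals over space and over `t` -/

section Swap

variable {d : ℕ} {α β : Measure (Rd d)} [SFinite β] {a b : Rd d → ℝ} {r s : ℝ}

lemma gaussEnergy_eq_integral_gaussPotential [SFinite α] {t : ℝ} (ht : 0 ≤ t) (ha : Integrable a α)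
    (hb : Integrable b β) :
    gaussEnergy t α β a b = ∫ x, a x * gaussPotential t β b x ∂α := by
  rw [gaussEnergy, integral_prod _ (integrable_gaussKernel_mul ht ha hb)]
  refine integral_congr_ae (Eventually.of_forall fun x => ?_)
  simp only [gaussPotential]
  rw [← integral_const_mul]
  refine integral_congr_ae (Eventually.of_forall fun y => ?_)
  simp only [gaussKernel_comm t y x]
  ring

lemma integrableOn_rpow_Ioc (p : ℝ) (hs : 0 < s) : IntegrableOn (fun t : ℝ => t ^ p) (Ioc s r) :=
  (ContinuousOn.integrableOn_Icc (continuousOn_id.rpow_const fun _ ht =>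
    Or.inl (hs.trans_le ht.1).ne')).mono_set Ioc_subset_Icc_self

/-- Staying on a bounded interval away from `t = 0` makes `t ^ p` integrable for every exponent, and
the Gaussian is at most `1`. -/
lemma integrable_rpow_mul_gaussPotential (p : ℝ) (hs : 0 < s) (ha : Integrable a α)
    (hb : Integrable b β) :
    Integrable (fun q : ℝ × Rd d => q.1 ^ p * (a q.2 * gaussPotential q.1 β b q.2))
      ((volume.restrict (Ioc s r)).prod α) := by
  have h := ((integrableOn_rpow_Ioc (r := r) p hs).mul_prod ha).mul_prod hb
  have hF : Integrable (fun q : (ℝ × Rd d) × Rd d => gaussKernel q.1.1 q.2 q.1.2 *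
      (q.1.1 ^ p * a q.1.2 * b q.2)) (((volume.restrict (Ioc s r)).prod α).prod β) := by
    refine h.mono (by have := h.aestronglyMeasurable; fun_prop) ?_
    have : ∀ᵐ q ∂(((volume.restrict (Ioc s r)).prod α).prod β), q.1.1 ∈ Ioc s r :=
      (Measure.quasiMeasurePreserving_fst.ae
        (Measure.quasiMeasurePreserving_fst.ae (ae_restrict_mem measurableSet_Ioc)))
    filter_upwards [this] with q hq
    rw [norm_mul, Real.norm_of_nonneg (gaussKernel_pos _ _ _).le]
    exact mul_le_of_le_one_left (norm_nonneg _) (gaussKernel_le_one (hs.trans hq.1).le _ _)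
  refine hF.integral_prod_left.congr (Eventually.of_forall fun q => ?_)
  simp only [gaussPotential]
  rw [← integral_const_mul, ← integral_const_mul]
  refine integral_congr_ae (Eventually.of_forall fun y => ?_)
  ring

lemma intervalIntegrable_rpow_mul_gaussEnergy [SFinite α] (p : ℝ) (hs : 0 < s) (hsr : s ≤ r)
    (ha : Integrable a α) (hb : Integrable b β) :
    IntervalIntegrable (fun t => t ^ p * gaussEnergy t α β a b) volume s r := by
  rw [intervalIntegrable_iff_integrableOn_Ioc_of_le hsr]
  refine (integrable_rpow_mul_gaussPotential p hs ha hb).integral_prod_left.congr ?_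
  filter_upwards [ae_restrict_mem measurableSet_Ioc] with t ht
  rw [integral_const_mul, gaussEnergy_eq_integral_gaussPotential (hs.trans ht.1).le ha hb]

lemma integral_mul_intervalIntegral_gaussPotential [SFinite α] (p : ℝ) (hs : 0 < s) (hsr : s ≤ r)
    (ha : Integrable a α) (hb : Integrable b β) :
    ∫ x, a x * (∫ t in s..r, t ^ p * gaussPotential t β b x) ∂α =
      ∫ t in s..r, t ^ p * gaussEnergy t α β a b := by
  have h := integrable_rpow_mul_gaussPotential (r := r) p hs ha hb
  have e : ∀ x, a x * (∫ t in s..r, t ^ p * gaussPotential t β b x) =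
      ∫ t in Ioc s r, t ^ p * (a x * gaussPotential t β b x) := by
    intro x
    rw [← intervalIntegral.integral_const_mul, intervalIntegral.integral_of_le hsr]
    simp only [mul_left_comm]
  simp_rw [e]
  rw [intervalIntegral.integral_of_le hsr, ← integral_integral_swap h]
  refine setIntegral_congr_fun measurableSet_Ioc fun t ht => ?_
  rw [integral_const_mul, gaussEnergy_eq_integral_gaussPotential (hs.trans ht.1).le ha hb]

end Swap

/-! ### The Laplacian and the heat equation -/

section Heat

variable {d : ℕ} {φ : Rd d → ℝ}

/-- The Laplacian on `ℝ^d`. -/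
noncomputable def lapl (φ : Rd d → ℝ) (x : Rd d) : ℝ :=
  ∑ i : Fin d, fderiv ℝ (fun y => fderiv ℝ φ y (EuclideanSpace.single i 1)) x
    (EuclideanSpace.single i 1)

lemma contDiff_fderiv_apply (hφ : ContDiff ℝ ∞ φ) (v : Rd d) :
    ContDiff ℝ ∞ fun y => fderiv ℝ φ y v :=
  (hφ.fderiv_right (by simp)).clm_apply contDiff_const

lemma hasCompactSupport_fderiv_apply (hc : HasCompactSupport φ) (v : Rd d) :
    HasCompactSupport fun y => fderiv ℝ φ y v :=
  (hc.fderiv (𝕜 := ℝ)).comp_left (g := fun L : Rd d →L[ℝ] ℝ => L v) (by simp)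

lemma continuous_lapl (hφ : ContDiff ℝ ∞ φ) : Continuous (lapl φ) :=
  continuous_finsetSum _ fun _ _ =>
    (contDiff_fderiv_apply (contDiff_fderiv_apply hφ _) _).continuous

lemma hasCompactSupport_lapl (hc : HasCompactSupport φ) : HasCompactSupport (lapl φ) := by
  refine hc.mono' fun x hx => ?_
  by_contra h
  refine hx (Finset.sum_eq_zero fun i _ => ?_)
  have h1 := notMem_subset (tsupport_fderiv_subset ℝ (f := φ)) h
  have h2 : (fun y => fderiv ℝ φ y (EuclideanSpace.single i 1)) =ᶠ[𝓝 x] 0 := by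
    filter_upwards [notMem_tsupport_iff_eventuallyEq.1 h1] with y hy
    simp [hy]
  rw [h2.fderiv_eq]
  simp

lemma integral_mul_fderiv_apply_eq_neg {g : Rd d → ℝ} (hg : ContDiff ℝ ∞ g)
    (hφ : ContDiff ℝ ∞ φ) (hc : HasCompactSupport φ) (v : Rd d) :
    ∫ x, g x * fderiv ℝ φ x v = -∫ x, fderiv ℝ g x v * φ x := by
  refine integral_mul_fderiv_eq_neg_fderiv_mul_of_integrable ?_ ?_ ?_
    (fun x _ => hg.differentiable (by simp) x) fun x _ => hφ.differentiable (by simp) x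
  · exact ((contDiff_fderiv_apply hg v).continuous.mul hφ.continuous).integrable_of_hasCompactSupport
      hc.mul_left
  · exact (hg.continuous.mul (contDiff_fderiv_apply hφ v).continuous).integrable_of_hasCompactSupport
      (hasCompactSupport_fderiv_apply hc v).mul_left
  · exact (hg.continuous.mul hφ.continuous).integrable_of_hasCompactSupport hc.mul_left

lemma integral_mul_lapl {g : Rd d → ℝ} (hg : ContDiff ℝ ∞ g)
    (hφ : ContDiff ℝ ∞ φ) (hc : HasCompactSupport φ) :
    ∫ x, g x * lapl φ x = -∑ i : Fin d, ∫ x, fderiv ℝ g x (EuclideanSpace.single i 1) *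
      fderiv ℝ φ x (EuclideanSpace.single i 1) := by
  simp only [lapl, Finset.mul_sum]
  rw [integral_finsetSum, ← Finset.sum_neg_distrib]
  · exact Finset.sum_congr rfl fun i _ => integral_mul_fderiv_apply_eq_neg hg
      (contDiff_fderiv_apply hφ _) (hasCompactSupport_fderiv_apply hc _) _
  · intro i _
    have h1 := contDiff_fderiv_apply (contDiff_fderiv_apply hφ (EuclideanSpace.single i 1))
      (EuclideanSpace.single i 1)
    exact (hg.continuous.mul h1.continuous).integrable_of_hasCompactSupport
      (hasCompactSupport_fderiv_apply (hasCompactSupport_fderiv_apply hc _) _).mul_left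

lemma integral_mul_lapl_comm {g : Rd d → ℝ} (hg : ContDiff ℝ ∞ g)
    (hφ : ContDiff ℝ ∞ φ) (hc : HasCompactSupport φ) :
    ∫ x, g x * lapl φ x = ∫ x, lapl g x * φ x := by
  rw [integral_mul_lapl hg hφ hc]
  simp only [lapl, Finset.sum_mul]
  rw [integral_finsetSum, ← Finset.sum_neg_distrib]
  · exact Finset.sum_congr rfl fun i _ => by
      rw [integral_mul_fderiv_apply_eq_neg (contDiff_fderiv_apply hg _) hφ hc, neg_neg]
  · intro i _
    have h1 := contDiff_fderiv_apply (contDiff_fderiv_apply hg (EuclideanSpace.single i 1))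
      (EuclideanSpace.single i 1)
    exact (h1.continuous.mul hφ.continuous).integrable_of_hasCompactSupport hc.mul_left

lemma contDiff_gaussKernel (t : ℝ) (x : Rd d) : ContDiff ℝ ∞ fun z => gaussKernel t z x := by
  unfold gaussKernel
  exact ((contDiff_const.mul ((contDiff_id.sub contDiff_const).norm_sq ℝ))).exp

lemma hasFDerivAt_gaussKernel (t : ℝ) (x z : Rd d) :
    HasFDerivAt (fun z => gaussKernel t z x)
      ((-2 * t * gaussKernel t z x) • innerSL ℝ (z - x)) z := by
  have h := (((hasFDerivAt_id z).sub_const x).norm_sq.const_mul (-t)).exp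
  convert! h using 1
  ext v
  simp [gaussKernel]
  ring

lemma lapl_gaussKernel (t : ℝ) (x z : Rd d) :
    lapl (fun z => gaussKernel t z x) z =
      (4 * t ^ 2 * ‖z - x‖ ^ 2 - 2 * d * t) * gaussKernel t z x := by
  have h1 : ∀ v : Rd d, (fun y => fderiv ℝ (fun z => gaussKernel t z x) y v) =
      fun y => -2 * t * (gaussKernel t y x * inner ℝ v (y - x)) := by
    intro v
    ext y
    rw [(hasFDerivAt_gaussKernel t x y).fderiv]
    simp only [smul_apply, innerSL_apply_apply, smul_eq_mul, real_inner_comm v]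
    ring
  have h2 : ∀ v : Rd d, fderiv ℝ (fun y => -2 * t * (gaussKernel t y x * inner ℝ v (y - x))) z v =
      (4 * t ^ 2 * (inner ℝ v (z - x)) ^ 2 - 2 * t * ‖v‖ ^ 2) * gaussKernel t z x := by
    intro v
    have hi : HasFDerivAt (fun y : Rd d => inner ℝ v (y - x)) (innerSL ℝ v) z :=
      (innerSL ℝ v).hasFDerivAt.comp z ((hasFDerivAt_id z).sub_const x)
    have hm : HasFDerivAt (fun y => gaussKernel t y x * inner ℝ v (y - x)) _ z :=
      (hasFDerivAt_gaussKernel t x z).mul hi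
    rw [(hm.const_mul (-2 * t)).fderiv]
    simp only [smul_apply, add_apply, innerSL_apply_apply, smul_eq_mul, real_inner_comm v,
      real_inner_self_eq_norm_sq]
    ring
  simp only [lapl, h1, h2]
  rw [← Finset.sum_mul, Finset.sum_sub_distrib, ← Finset.mul_sum, EuclideanSpace.real_norm_sq_eq]
  simp only [EuclideanSpace.inner_single_left, map_one, one_mul, PiLp.norm_single, norm_one,
    one_pow, mul_one, Finset.sum_const, Finset.card_univ, Fintype.card_fin, nsmul_eq_mul]
  ring

lemma gaussPotential_lapl (t : ℝ) (hφ : ContDiff ℝ ∞ φ) (hc : HasCompactSupport φ) (x : Rd d) :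
    gaussPotential t volume (lapl φ) x =
      ∫ z, (4 * t ^ 2 * ‖z - x‖ ^ 2 - 2 * d * t) * gaussKernel t z x * φ z := by
  rw [gaussPotential, integral_mul_lapl_comm (contDiff_gaussKernel t x) hφ hc]
  simp_rw [lapl_gaussKernel]

/-- The heat equation in the variable `t = 1/(4 · time)`: the change of variable produces the factor
`-4` and the weight `t^(d/2-2)`, the weight of the Coulomb mixture. -/
lemma hasDerivAt_rpow_mul_gaussKernel {t : ℝ} (ht : 0 < t) (x z : Rd d) :
    HasDerivAt (fun t => -4 * (t ^ (d / 2 : ℝ) * gaussKernel t z x))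
      (t ^ (d / 2 - 2 : ℝ) * ((4 * t ^ 2 * ‖z - x‖ ^ 2 - 2 * d * t) * gaussKernel t z x)) t := by
  have h1 := (hasDerivAt_id t).rpow_const (p := (d / 2 : ℝ)) (Or.inl ht.ne')
  have h2 := (((hasDerivAt_id t).neg).mul_const (‖z - x‖ ^ 2)).exp
  have h := (h1.mul h2).const_mul (-4)
  convert! h using 1
  simp only [gaussKernel, id, Pi.neg_apply]
  have e1 : t ^ (d / 2 - 1 : ℝ) = t ^ (d / 2 - 2 : ℝ) * t := by
    rw [← Real.rpow_add_one ht.ne']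
    ring_nf
  have e2 : t ^ (d / 2 : ℝ) = t ^ (d / 2 - 2 : ℝ) * t ^ 2 := by
    rw [← Real.rpow_natCast, ← Real.rpow_add ht]
    push_cast
    ring_nf
  rw [e1, e2]
  ring

/-- The Gaussian mean `t^{d/2} ∫ exp (-t |x - z|²) φ(z) dz`. -/
noncomputable def gaussMean (t : ℝ) (φ : Rd d → ℝ) (x : Rd d) : ℝ :=
  t ^ (d / 2 : ℝ) * gaussPotential t volume φ x

/-- The heat equation in integrated form. -/
lemma intervalIntegral_gaussPotential_lapl {s r : ℝ} (hs : 0 < s) (hsr : s ≤ r)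
    (hφ : ContDiff ℝ ∞ φ) (hc : HasCompactSupport φ) (x : Rd d) :
    ∫ t in s..r, t ^ (d / 2 - 2 : ℝ) * gaussPotential t volume (lapl φ) x =
      -4 * (gaussMean r φ x - gaussMean s φ x) := by
  have hcont : ∀ z, ContinuousOn (fun t : ℝ => t ^ (d / 2 - 2 : ℝ) *
      ((4 * t ^ 2 * ‖z - x‖ ^ 2 - 2 * d * t) * gaussKernel t z x) * φ z) (Icc s r) := by
    intro z
    refine ((continuousOn_id.rpow_const fun t ht => Or.inl (hs.trans_le ht.1).ne').mul ?_).mul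
      continuousOn_const
    fun_prop
  have hcont2 : ContinuousOn (fun q : ℝ × Rd d => q.1 ^ (d / 2 - 2 : ℝ) *
      ((4 * q.1 ^ 2 * ‖q.2 - x‖ ^ 2 - 2 * d * q.1) * gaussKernel q.1 q.2 x) * φ q.2)
      (Icc s r ×ˢ tsupport φ) := by
    have := hφ.continuous
    refine ((continuousOn_fst.rpow_const fun q hq =>
      Or.inl (hs.trans_le hq.1.1).ne').mul ?_).mul (by fun_prop)
    fun_prop
  -- Fubini is justified by continuity on the compact set `[s, r] × supp φ`.
  have hint := (hcont2.integrableOn_compact (μ := volume.prod volume) (isCompact_Icc.prod hc)).mono_set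
    (prod_mono_left Ioc_subset_Icc_self)
  rw [IntegrableOn, ← Measure.prod_restrict] at hint
  have e1 : ∀ t, t ^ (d / 2 - 2 : ℝ) * gaussPotential t volume (lapl φ) x =
      ∫ z in tsupport φ, t ^ (d / 2 - 2 : ℝ) *
      ((4 * t ^ 2 * ‖z - x‖ ^ 2 - 2 * d * t) * gaussKernel t z x) * φ z := by
    intro t
    rw [gaussPotential_lapl t hφ hc, setIntegral_eq_integral_of_forall_compl_eq_zero,
      ← integral_const_mul]
    · refine integral_congr_ae (Eventually.of_forall fun z => ?_)
      ring
    · intro z hz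
      rw [image_eq_zero_of_notMem_tsupport hz, mul_zero]
  have e2 : ∀ t, gaussMean t φ x = ∫ z in tsupport φ, t ^ (d / 2 : ℝ) * gaussKernel t z x * φ z := by
    intro t
    rw [gaussMean, gaussPotential, setIntegral_eq_integral_of_forall_compl_eq_zero,
      ← integral_const_mul]
    · refine integral_congr_ae (Eventually.of_forall fun z => ?_)
      ring
    · intro z hz
      rw [image_eq_zero_of_notMem_tsupport hz, mul_zero]
  have e3 : ∀ t, IntegrableOn (fun z => t ^ (d / 2 : ℝ) * gaussKernel t z x * φ z) (tsupport φ) := by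
    intro t
    have := hφ.continuous
    exact ContinuousOn.integrableOn_compact hc (by fun_prop)
  simp_rw [e1, e2]
  rw [intervalIntegral.integral_of_le hsr, integral_integral_swap hint,
    ← integral_sub (e3 r) (e3 s), ← integral_const_mul]
  refine integral_congr_ae (Eventually.of_forall fun z => ?_)
  simp only
  rw [← intervalIntegral.integral_of_le hsr, intervalIntegral.integral_eq_sub_of_hasDerivAt
    (f := fun t => -4 * (t ^ (d / 2 : ℝ) * gaussKernel t z x) * φ z)]
  · ring
  · intro t ht
    rw [uIcc_of_le hsr] at ht
    exact (hasDerivAt_rpow_mul_gaussKernel (hs.trans_le ht.1) x z).mul_const _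
  · rw [intervalIntegrable_iff_integrableOn_Icc_of_le hsr]
    exact (hcont z).integrableOn_Icc

end Heat

/-! ### Gaussian means for large and small `t` -/

section Limits

variable {d : ℕ} {φ : Rd d → ℝ}

lemma integral_gaussKernel {t : ℝ} (ht : 0 < t) (x : Rd d) :
    ∫ z, gaussKernel t z x = (Real.pi / t) ^ (d / 2 : ℝ) := by
  unfold gaussKernel
  rw [integral_sub_right_eq_self (fun z : Rd d => Real.exp (-t * ‖z‖ ^ 2)),
    GaussianFourier.integral_rexp_neg_mul_sq_norm ht]
  simp

/-- The bound does not depend on `t`, so it serves as the dominating function in the limit `r → ∞`.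
-/
lemma abs_gaussMean_le {t M : ℝ} (ht : 0 < t) (hM : ∀ x, |φ x| ≤ M) (x : Rd d) :
    |gaussMean t φ x| ≤ Real.pi ^ (d / 2 : ℝ) * M := by
  have hi : Integrable fun z => gaussKernel t z x := by
    simp_rw [gaussKernel_comm t _ x]
    exact integrable_gaussKernel ht x
  have h1 : |gaussPotential t volume φ x| ≤ (Real.pi / t) ^ (d / 2 : ℝ) * M := by
    rw [← integral_gaussKernel ht x, ← integral_mul_const, ← Real.norm_eq_abs, gaussPotential]
    refine norm_integral_le_of_norm_le (hi.mul_const M) (Eventually.of_forall fun z => ?_)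
    rw [norm_mul, Real.norm_of_nonneg (gaussKernel_pos _ _ _).le]
    exact mul_le_mul_of_nonneg_left (hM z) (gaussKernel_pos _ _ _).le
  have ht' := Real.rpow_pos_of_pos ht (d / 2 : ℝ)
  rw [gaussMean, abs_mul, abs_of_pos ht']
  refine (mul_le_mul_of_nonneg_left h1 ht'.le).trans_eq ?_
  rw [Real.div_rpow Real.pi_pos.le ht.le]
  field_simp

lemma abs_gaussMean_le_rpow {t : ℝ} (ht : 0 < t) (hφ : Integrable φ) (x : Rd d) :
    |gaussMean t φ x| ≤ t ^ (d / 2 : ℝ) * ∫ z, |φ z| := by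
  have ht' := Real.rpow_pos_of_pos ht (d / 2 : ℝ)
  rw [gaussMean, abs_mul, abs_of_pos ht']
  refine mul_le_mul_of_nonneg_left ?_ ht'.le
  rw [← Real.norm_eq_abs, gaussPotential]
  refine norm_integral_le_of_norm_le hφ.abs (Eventually.of_forall fun z => ?_)
  rw [norm_mul, Real.norm_of_nonneg (gaussKernel_pos _ _ _).le]
  exact mul_le_of_le_one_left (norm_nonneg _) (gaussKernel_le_one ht.le _ _)

lemma tendsto_norm_pow_mul_exp_neg_sq (n : ℕ) :
    Tendsto (fun x : Rd d => ‖x‖ ^ n * Real.exp (-‖x‖ ^ 2)) (Bornology.cobounded (Rd d)) (𝓝 0) := by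
  have h := (Real.tendsto_pow_mul_exp_neg_atTop_nhds_zero n).comp
    (tendsto_norm_cobounded_atTop (E := Rd d))
  refine squeeze_zero' (Eventually.of_forall fun x => by positivity) ?_ h
  filter_upwards [tendsto_norm_cobounded_atTop.eventually_ge_atTop 1] with x hx
  simp only [Function.comp]
  gcongr
  nlinarith

lemma tendsto_gaussMean_atTop (hφ : Continuous φ) (hi : Integrable φ) (x : Rd d) :
    Tendsto (fun t => gaussMean t φ x) atTop (𝓝 (Real.pi ^ (d / 2 : ℝ) * φ x)) := by
  have hpi : 0 < Real.pi ^ (d / 2 : ℝ) := Real.rpow_pos_of_pos Real.pi_pos _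
  have h1 : ∫ y : Rd d, (Real.pi ^ (d / 2 : ℝ))⁻¹ * Real.exp (-‖y‖ ^ 2) = 1 := by
    have := integral_gaussKernel one_pos (0 : Rd d)
    simp only [gaussKernel, sub_zero, div_one, neg_mul, one_mul] at this
    rw [integral_const_mul, this, inv_mul_cancel₀ hpi.ne']
  have h2 : Tendsto (fun y : Rd d => ‖y‖ ^ (Module.finrank ℝ (Rd d)) *
      ((Real.pi ^ (d / 2 : ℝ))⁻¹ * Real.exp (-‖y‖ ^ 2))) (Bornology.cobounded (Rd d)) (𝓝 0) := by
    have := (tendsto_norm_pow_mul_exp_neg_sq (d := d) (Module.finrank ℝ (Rd d))).const_mul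
      ((Real.pi ^ (d / 2 : ℝ))⁻¹)
    rw [mul_zero] at this
    exact this.congr fun y => by ring
  -- The normalized Gaussian, rescaled by `√t`, is an approximate identity.
  have h := tendsto_integral_comp_smul_smul_of_integrable' (fun y => by positivity) h1 h2 hi
    (hφ.continuousAt (x := x))
  refine ((h.comp Real.tendsto_sqrt_atTop).const_mul (Real.pi ^ (d / 2 : ℝ))).congr' ?_
  filter_upwards [eventually_gt_atTop 0] with t ht
  simp only [Function.comp, finrank_euclideanSpace, Fintype.card_fin, smul_eq_mul]
  rw [gaussMean, gaussPotential, ← integral_const_mul, ← integral_const_mul]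
  refine integral_congr_ae (Eventually.of_forall fun z => ?_)
  have e : √t ^ d = t ^ (d / 2 : ℝ) := by
    rw [Real.sqrt_eq_rpow, ← Real.rpow_natCast, ← Real.rpow_mul ht.le]
    ring_nf
  simp only [e, gaussKernel, norm_smul, mul_pow, Real.norm_eq_abs, sq_abs, Real.sq_sqrt ht.le,
    norm_sub_rev x z, neg_mul]
  field_simp

lemma tendsto_gaussMean_inv_atTop (hd : 0 < d) (hi : Integrable φ) (x : Rd d) :
    Tendsto (fun t => gaussMean t⁻¹ φ x) atTop (𝓝 0) := by
  have hp : (0 : ℝ) < d / 2 := by positivity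
  have h : Tendsto (fun t : ℝ => (t⁻¹) ^ (d / 2 : ℝ) * ∫ z, |φ z|) atTop (𝓝 0) := by
    have := (((Real.continuous_rpow_const hp.le).tendsto' 0 0 (Real.zero_rpow hp.ne')).comp
      tendsto_inv_atTop_zero).mul_const (∫ z, |φ z|)
    simpa using this
  refine squeeze_zero_norm' ?_ h
  filter_upwards [eventually_gt_atTop 0] with t ht
  exact abs_gaussMean_le_rpow (inv_pos.2 ht) hi x

lemma aestronglyMeasurable_gaussMean {α : Measure (Rd d)} (t : ℝ) (hφ : Continuous φ) :
    AEStronglyMeasurable (gaussMean t φ) α := by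
  have h : Continuous fun p : Rd d × Rd d => gaussKernel t p.2 p.1 * φ p.2 := by fun_prop
  exact (h.stronglyMeasurable.integral_prod_right (ν := volume)).aestronglyMeasurable.const_mul _

lemma tendsto_integral_mul_gaussMean {α : Measure (Rd d)} {a : Rd d → ℝ} (ha : Integrable a α)
    (hd : 0 < d) (hφ : Continuous φ) (hc : HasCompactSupport φ) :
    Tendsto (fun r => ∫ x, a x * (gaussMean r φ x - gaussMean r⁻¹ φ x) ∂α) atTop
      (𝓝 (Real.pi ^ (d / 2 : ℝ) * ∫ x, a x * φ x ∂α)) := by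
  obtain ⟨M, hM⟩ := hc.exists_bound_of_continuous hφ
  have hi : Integrable φ := hφ.integrable_of_hasCompactSupport hc
  rw [← integral_const_mul]
  refine tendsto_integral_filter_of_dominated_convergence
    (fun x => |a x| * (2 * (Real.pi ^ (d / 2 : ℝ) * M))) ?_ ?_ (ha.abs.mul_const _) ?_
  · exact Eventually.of_forall fun r => ha.1.mul
      ((aestronglyMeasurable_gaussMean r hφ).sub (aestronglyMeasurable_gaussMean r⁻¹ hφ))
  · filter_upwards [eventually_gt_atTop 0] with r hr
    refine Eventually.of_forall fun x => ?_
    rw [norm_mul, Real.norm_eq_abs, Real.norm_eq_abs]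
    refine mul_le_mul_of_nonneg_left ?_ (abs_nonneg _)
    refine (abs_sub _ _).trans ?_
    linarith [abs_gaussMean_le hr hM x, abs_gaussMean_le (inv_pos.2 hr) hM x]
  · refine Eventually.of_forall fun x => ?_
    have := ((tendsto_gaussMean_atTop hφ hi x).sub
      (tendsto_gaussMean_inv_atTop hd hi x)).const_mul (a x)
    convert! this using 2
    ring

end Limits

/-! ### Pairing with smooth test functions -/

section TestFunctions

variable {d : ℕ} {φ : Rd d → ℝ}

lemma intervalIntegral_gaussEnergy_lapl {α : Measure (Rd d)} [SFinite α] {a : Rd d → ℝ}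
    (ha : Integrable a α) (hφ : ContDiff ℝ ∞ φ) (hc : HasCompactSupport φ) {s r : ℝ} (hs : 0 < s)
    (hsr : s ≤ r) :
    ∫ t in s..r, t ^ (d / 2 - 2 : ℝ) * gaussEnergy t α volume a (lapl φ) =
      -4 * ∫ x, a x * (gaussMean r φ x - gaussMean s φ x) ∂α := by
  rw [← integral_mul_intervalIntegral_gaussPotential _ hs hsr ha
    ((continuous_lapl hφ).integrable_of_hasCompactSupport (hasCompactSupport_lapl hc)),
    ← integral_const_mul]
  refine integral_congr_ae (Eventually.of_forall fun x => ?_)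
  simp only [intervalIntegral_gaussPotential_lapl hs hsr hφ hc]
  ring

/-- The Gaussian mixture of energies that makes up the Coulomb energy. -/
noncomputable def mixedEnergy (α : Measure (Rd d)) (a : Rd d → ℝ) : ℝ≥0∞ :=
  ∫⁻ t in Ioi (0 : ℝ), ENNReal.ofReal (t ^ (d / 2 - 2 : ℝ) * gaussEnergy t α α a a)

lemma intervalIntegral_gaussEnergy_le {α : Measure (Rd d)} [SFinite α] {a : Rd d → ℝ}
    (ha : Integrable a α) (hD : mixedEnergy α a ≠ ⊤) {s r : ℝ} (hs : 0 < s) (hsr : s ≤ r) :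
    ∫ t in s..r, t ^ (d / 2 - 2 : ℝ) * gaussEnergy t α α a a ≤ (mixedEnergy α a).toReal := by
  have hi := intervalIntegrable_rpow_mul_gaussEnergy (d / 2 - 2 : ℝ) hs hsr ha ha
  rw [intervalIntegrable_iff_integrableOn_Ioc_of_le hsr] at hi
  rw [intervalIntegral.integral_of_le hsr, integral_eq_lintegral_of_nonneg_ae _ hi.1]
  · refine ENNReal.toReal_mono hD (lintegral_mono_set fun t ht => hs.trans ht.1)
  · filter_upwards [ae_restrict_mem measurableSet_Ioc] with t ht
    have ht0 := hs.trans ht.1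
    exact mul_nonneg (Real.rpow_nonneg ht0.le _) (gaussEnergy_self_nonneg ht0 ha)

/-- Cauchy–Schwarz of `a` against `Δφ` is integrated over `[1/r, r]` and `r → ∞`. The heat equation
evaluates both the mixed term and the energy of `Δφ`; the `8` is the `2` of Cauchy–Schwarz times the
`4` of the heat equation. -/
lemma two_mul_abs_integral_mul_le {α : Measure (Rd d)} [SFinite α] {a : Rd d → ℝ} (hd : 0 < d)
    (ha : Integrable a α) (hD : mixedEnergy α a ≠ ⊤) (hφ : ContDiff ℝ ∞ φ)
    (hc : HasCompactSupport φ) {c : ℝ} (hc0 : 0 < c) :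
    8 * (Real.pi ^ (d / 2 : ℝ) * |∫ x, a x * φ x ∂α|) ≤ c * (mixedEnergy α a).toReal +
      c⁻¹ * (-4 * (Real.pi ^ (d / 2 : ℝ) * ∫ x, lapl φ x * φ x)) := by
  have hψ : Integrable (lapl φ) :=
    (continuous_lapl hφ).integrable_of_hasCompactSupport (hasCompactSupport_lapl hc)
  have hpi : 0 < Real.pi ^ (d / 2 : ℝ) := Real.rpow_pos_of_pos Real.pi_pos _
  have l1 := ((tendsto_integral_mul_gaussMean ha hd hφ.continuous hc).abs).const_mul 8
  have l2 := ((((tendsto_integral_mul_gaussMean hψ hd hφ.continuous hc).const_mul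
    (-4)).const_mul c⁻¹).const_add (c * (mixedEnergy α a).toReal))
  rw [abs_mul, abs_of_pos hpi] at l1
  refine le_of_tendsto_of_tendsto l1 l2 ?_
  filter_upwards [eventually_ge_atTop 1] with r hr
  have hs : 0 < r⁻¹ := by positivity
  have hsr : r⁻¹ ≤ r := (inv_le_one_of_one_le₀ hr).trans hr
  rw [← intervalIntegral_gaussEnergy_lapl hψ hφ hc hs hsr]
  have e := intervalIntegral_gaussEnergy_lapl ha hφ hc hs hsr
  have i1 := intervalIntegrable_rpow_mul_gaussEnergy (d / 2 - 2 : ℝ) hs hsr ha ha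
  have i2 := intervalIntegrable_rpow_mul_gaussEnergy (d / 2 - 2 : ℝ) hs hsr ha hψ
  have i3 := intervalIntegrable_rpow_mul_gaussEnergy (d / 2 - 2 : ℝ) hs hsr hψ hψ
  have h1 : 8 * |∫ x, a x * (gaussMean r φ x - gaussMean r⁻¹ φ x) ∂α| =
      2 * |∫ t in r⁻¹..r, t ^ (d / 2 - 2 : ℝ) * gaussEnergy t α volume a (lapl φ)| := by
    rw [e, abs_mul]
    norm_num
    ring
  rw [h1]
  have h2 : 2 * |∫ t in r⁻¹..r, t ^ (d / 2 - 2 : ℝ) * gaussEnergy t α volume a (lapl φ)| ≤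
      ∫ t in r⁻¹..r, (c * (t ^ (d / 2 - 2 : ℝ) * gaussEnergy t α α a a) +
        c⁻¹ * (t ^ (d / 2 - 2 : ℝ) * gaussEnergy t volume volume (lapl φ) (lapl φ))) := by
    refine (mul_le_mul_of_nonneg_left (intervalIntegral.abs_integral_le_integral_abs hsr)
      zero_le_two).trans ?_
    rw [← intervalIntegral.integral_const_mul]
    refine intervalIntegral.integral_mono_on hsr (i2.abs.const_mul 2)
      ((i1.const_mul c).add (i3.const_mul c⁻¹)) fun t ht => ?_
    have ht0 : 0 < t := hs.trans_le ht.1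
    have hw := Real.rpow_pos_of_pos ht0 (d / 2 - 2 : ℝ)
    rw [abs_mul, abs_of_pos hw]
    linear_combination t ^ (d / 2 - 2 : ℝ) * two_mul_abs_gaussEnergy_le ht0 ha hψ hc0
  refine h2.trans ?_
  rw [intervalIntegral.integral_add (i1.const_mul c) (i3.const_mul c⁻¹),
    intervalIntegral.integral_const_mul, intervalIntegral.integral_const_mul]
  have := mul_le_mul_of_nonneg_left (intervalIntegral_gaussEnergy_le ha hD hs hsr) hc0.le
  linarith

lemma sq_le_mul_of_forall_pos {x A B : ℝ} (hA : 0 ≤ A) (hB : 0 ≤ B)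
    (h : ∀ c > 0, 2 * x ≤ c * A + c⁻¹ * B) (hx : 0 ≤ x) : x ^ 2 ≤ A * B := by
  rcases hx.eq_or_lt with rfl | hx
  · simpa using mul_nonneg hA hB
  rcases hA.eq_or_lt with rfl | hA
  -- If `A = 0` there is no optimal `c`; this large one gives `2x ≤ x B / (B + 1)`, which is
  -- impossible for `x > 0`.
  · have := h ((B + 1) / x) (by positivity)
    rw [inv_div, mul_zero, zero_add, div_mul_eq_mul_div, le_div_iff₀ (by positivity)] at this
    nlinarith
  · have := h (x / A) (by positivity)
    rw [div_mul_cancel₀ _ hA.ne', inv_div] at this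
    have h2 : x ≤ A / x * B := by linarith
    rw [div_mul_eq_mul_div, le_div_iff₀ hx] at h2
    nlinarith

/-- By parts, the left side is the Dirichlet energy, a sum of `d` squared partial derivatives living
on the ball. -/
lemma neg_integral_lapl_mul_le (hφ : ContDiff ℝ ∞ φ) {R N : ℝ}
    (hR : tsupport φ ⊆ Metric.closedBall 0 R) (hN : ∀ x, ‖fderiv ℝ φ x‖ ≤ N) :
    -∫ x, lapl φ x * φ x ≤ d * volume.real (Metric.closedBall (0 : Rd d) R) * N ^ 2 := by
  have hc : HasCompactSupport φ :=
    (isCompact_closedBall 0 R).of_isClosed_subset (isClosed_tsupport φ) hR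
  rw [← integral_mul_lapl_comm hφ hφ hc, integral_mul_lapl hφ hφ hc, neg_neg]
  have : ∀ i : Fin d, ∫ x, fderiv ℝ φ x (EuclideanSpace.single i 1) *
      fderiv ℝ φ x (EuclideanSpace.single i 1) ≤
      volume.real (Metric.closedBall (0 : Rd d) R) * N ^ 2 := by
    intro i
    rw [← setIntegral_eq_integral_of_forall_compl_eq_zero (s := Metric.closedBall (0 : Rd d) R)]
    · have h1 := contDiff_fderiv_apply hφ (EuclideanSpace.single i 1)
      rw [← smul_eq_mul, ← setIntegral_const]
      refine setIntegral_mono_on ((h1.continuous.mul h1.continuous).continuousOn.integrableOn_compact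
        (isCompact_closedBall 0 R)) (integrableOn_const (measure_closedBall_lt_top).ne)
        measurableSet_closedBall fun x _ => ?_
      rw [← sq]
      refine sq_le_sq' ?_ ?_ <;>
      · have := ((fderiv ℝ φ x).le_opNorm (EuclideanSpace.single i 1)).trans_eq
          (by rw [PiLp.norm_single, norm_one, mul_one])
        have := abs_le.1 (this.trans (hN x))
        linarith
    · intro x hx
      have : fderiv ℝ φ x = 0 := image_eq_zero_of_notMem_tsupport
        (notMem_subset (tsupport_fderiv_subset ℝ) (notMem_subset hR hx))
      simp [this]
  refine (Finset.sum_le_sum fun i _ => this i).trans_eq ?_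
  simp
  ring

/-- The energy controls the pairing with test functions. -/
lemma exists_sq_integral_mul_le (hd : 0 < d) (R : ℝ) :
    ∃ A : ℝ, 0 < A ∧ ∀ (α : Measure (Rd d)) [SFinite α] (a : Rd d → ℝ), Integrable a α →
      mixedEnergy α a ≠ ⊤ → ∀ (φ : Rd d → ℝ) (N : ℝ), ContDiff ℝ ∞ φ →
      tsupport φ ⊆ Metric.closedBall 0 R → (∀ x, ‖fderiv ℝ φ x‖ ≤ N) →
      |∫ x, a x * φ x ∂α| ≤ A * N * √(mixedEnergy α a).toReal := by
  have hpi : 0 < Real.pi ^ (d / 2 : ℝ) := Real.rpow_pos_of_pos Real.pi_pos _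
  set P := Real.pi ^ (d / 2 : ℝ)
  set V := volume.real (Metric.closedBall (0 : Rd d) R)
  have hV : 0 ≤ V := measureReal_nonneg
  -- The square root is what optimizing in `c` yields; the `+ 1` only secures strict positivity.
  refine ⟨√(d * V / (4 * P)) + 1, by positivity, fun α _ a ha hD φ N hφ hR hN => ?_⟩
  have hN0 : 0 ≤ N := (norm_nonneg _).trans (hN 0)
  have hc : HasCompactSupport φ :=
    (isCompact_closedBall 0 R).of_isClosed_subset (isClosed_tsupport φ) hR
  set D := (mixedEnergy α a).toReal
  have hD0 : 0 ≤ D := ENNReal.toReal_nonneg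
  have h := sq_le_mul_of_forall_pos (x := 4 * (P * |∫ x, a x * φ x ∂α|)) (A := D)
    (B := 4 * P * (d * V * N ^ 2)) hD0 (by positivity) (fun c hc0 => ?_) (by positivity)
  · have h2 : |∫ x, a x * φ x ∂α| ^ 2 ≤ (√(d * V / (4 * P)) * N * √D) ^ 2 := by
      rw [mul_pow, mul_pow, Real.sq_sqrt (by positivity), Real.sq_sqrt hD0, div_mul_eq_mul_div,
        div_mul_eq_mul_div, le_div_iff₀ (by positivity)]
      refine le_of_mul_le_mul_left ?_ (by positivity : 0 < 4 * P)
      linarith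
    refine (pow_le_pow_iff_left₀ (abs_nonneg _) (by positivity) two_ne_zero).1 h2 |>.trans ?_
    gcongr
    linarith
  · have h1 := two_mul_abs_integral_mul_le hd ha hD hφ hc hc0
    have h2 := mul_le_mul_of_nonneg_left (neg_integral_lapl_mul_le hφ hR hN)
      (by positivity : 0 ≤ c⁻¹ * (4 * P))
    linarith

end TestFunctions

/-! ### From smooth test functions to bounded Lipschitz ones -/

section Mollify

open ContinuousLinearMap
open scoped Convolution

variable {d : ℕ} {f : Rd d → ℝ} {G : Rd d → Rd d}

/-- The almost everywhere bound holds on a dense set, which is closed by continuity, hence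
everywhere. This matters because `μ` may charge Lebesgue-null sets. -/
lemma abs_le_normW1Inf (hf : Continuous f) (h : normW1Inf f G < ⊤) (x : Rd d) :
    |f x| ≤ (normW1Inf f G).toReal := by
  have h1 : eLpNormEssSup f volume ≤ normW1Inf f G := by
    rw [← eLpNorm_exponent_top]
    exact le_max_left _ _
  have h2 : ∀ᵐ y, |f y| ≤ (normW1Inf f G).toReal := by
    filter_upwards [ae_le_eLpNormEssSup (f := f) (μ := volume)] with y hy
    have := ENNReal.toReal_mono h.ne (hy.trans h1)
    simpa using this
  have h3 : IsClosed {y | |f y| ≤ (normW1Inf f G).toReal} :=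
    isClosed_le hf.abs continuous_const
  have h4 : Dense {y | |f y| ≤ (normW1Inf f G).toReal} :=
    Measure.dense_of_ae h2
  exact (h3.closure_eq ▸ h4.closure_eq ▸ mem_univ x : x ∈ {y | |f y| ≤ (normW1Inf f G).toReal})

lemma ae_norm_weakGradient_le (h : normW1Inf f G < ⊤) :
    ∀ᵐ y, ‖G y‖ ≤ (normW1Inf f G).toReal := by
  have h1 : eLpNormEssSup G volume ≤ normW1Inf f G := by
    rw [← eLpNorm_exponent_top]
    exact le_max_right _ _
  filter_upwards [ae_le_eLpNormEssSup (f := G) (μ := volume)] with y hy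
  simpa using ENNReal.toReal_mono h.ne (hy.trans h1)

/-- The mollification of `f` by a smooth bump function. -/
noncomputable def mollify (ρ : ContDiffBump (0 : Rd d)) (f : Rd d → ℝ) : Rd d → ℝ :=
  ρ.normed volume ⋆[lsmul ℝ ℝ, volume] f

variable (ρ : ContDiffBump (0 : Rd d))

lemma contDiff_mollify (hf : LocallyIntegrable f) : ContDiff ℝ ∞ (mollify ρ f) :=
  ρ.hasCompactSupport_normed.contDiff_convolution_left _ ρ.contDiff_normed hf

lemma integrable_normed_sub (x : Rd d) : Integrable fun z => ρ.normed volume (x - z) :=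
  (ρ.continuous_normed.integrable_of_hasCompactSupport ρ.hasCompactSupport_normed).comp_sub_left x

lemma integral_normed_sub (x : Rd d) : ∫ z, ρ.normed volume (x - z) = 1 := by
  rw [integral_sub_left_eq_self (fun z => ρ.normed volume z), ρ.integral_normed]

lemma abs_integral_normed_sub_mul_le {g : Rd d → ℝ} {M : ℝ} (hg : ∀ᵐ z, |g z| ≤ M) (x : Rd d) :
    |∫ z, ρ.normed volume (x - z) * g z| ≤ M := by
  have : ∫ z, ρ.normed volume (x - z) * M = M := by
    rw [integral_mul_const, integral_normed_sub, one_mul]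
  rw [← Real.norm_eq_abs, ← this]
  refine norm_integral_le_of_norm_le ((integrable_normed_sub ρ x).mul_const M) ?_
  filter_upwards [hg] with z hz
  rw [norm_mul, Real.norm_of_nonneg (ρ.nonneg_normed _)]
  exact mul_le_mul_of_nonneg_left hz (ρ.nonneg_normed _)

lemma abs_mollify_le {M : ℝ} (hf : ∀ x, |f x| ≤ M) (x : Rd d) : |mollify ρ f x| ≤ M := by
  rw [mollify, convolution_eq_swap]
  exact abs_integral_normed_sub_mul_le ρ (Eventually.of_forall hf) x

/-- The derivative falls on the bump; testing the weak gradient with `z ↦ ρ (x - z)` moves it to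
`f`. -/
lemma fderiv_mollify (hG : HasWeakGradient f G) (x v : Rd d) :
    fderiv ℝ (mollify ρ f) x v = ∫ z, ρ.normed volume (x - z) * inner ℝ (G z) v := by
  have hsm : ContDiff ℝ ∞ (ρ.normed volume) := ρ.contDiff_normed
  have h1 := ρ.hasCompactSupport_normed.hasFDerivAt_convolution_left (lsmul ℝ ℝ)
    (ρ.contDiff_normed (n := 1) (μ := volume)) hG.1 x
  have hcd : HasCompactSupport (fderiv ℝ (ρ.normed volume)) :=
    ρ.hasCompactSupport_normed.fderiv (𝕜 := ℝ)
  have hex : ConvolutionExistsAt (fderiv ℝ (ρ.normed volume)) f x (precompL (Rd d) (lsmul ℝ ℝ))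
      volume := hcd.convolutionExists_left _ (hsm.continuous_fderiv (by simp)) hG.1 x
  rw [mollify, h1.fderiv, convolution_eq_swap, integral_apply hex.integrable_swap]
  have h2 : ∀ z, fderiv ℝ (fun z => ρ.normed volume (x - z)) z v =
      -fderiv ℝ (ρ.normed volume) (x - z) v := by
    intro z
    have := (hsm.differentiable (by simp) (x - z)).hasFDerivAt.comp z
      ((hasFDerivAt_id z).const_sub x)
    have h3 : HasFDerivAt (fun z => ρ.normed volume (x - z)) _ z := this
    rw [h3.fderiv]
    simp
  have h4 := hG.2.2 (fun z => ρ.normed volume (x - z)) (hsm.comp (contDiff_const.sub contDiff_id))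
    (ρ.hasCompactSupport_normed.comp_homeomorph (Homeomorph.subLeft x)) v
  simp only [h2, mul_neg, integral_neg, neg_inj] at h4
  simp only [precompL_apply, lsmul_apply, smul_eq_mul]
  simpa only [mul_comm] using h4

lemma norm_fderiv_mollify_le (hG : HasWeakGradient f G) {M : ℝ} (hM : ∀ᵐ z, ‖G z‖ ≤ M)
    (hM0 : 0 ≤ M) (x : Rd d) : ‖fderiv ℝ (mollify ρ f) x‖ ≤ M := by
  refine opNorm_le_bound _ hM0 fun v => ?_
  rw [fderiv_mollify ρ hG, Real.norm_eq_abs]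
  refine abs_integral_normed_sub_mul_le ρ ?_ x
  filter_upwards [hM] with z hz
  exact (abs_real_inner_le_norm _ _).trans (mul_le_mul_of_nonneg_right hz (norm_nonneg v))

/-- The energy controls the pairing with compactly cut off bounded Lipschitz functions. -/
lemma exists_abs_integral_mul_cutoff_le (hd : 0 < d) {R L : ℝ} {χ : Rd d → ℝ}
    (hχ : ContDiff ℝ ∞ χ) (hR : tsupport χ ⊆ Metric.closedBall 0 R) (h1 : ∀ x, |χ x| ≤ 1)
    (hL : ∀ x, ‖fderiv ℝ χ x‖ ≤ L) :
    ∃ A : ℝ, 0 < A ∧ ∀ (α : Measure (Rd d)) [SFinite α] (a : Rd d → ℝ), Integrable a α →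
      mixedEnergy α a ≠ ⊤ → ∀ (f : Rd d → ℝ) (G : Rd d → Rd d), Continuous f →
      HasWeakGradient f G → normW1Inf f G < ⊤ →
      |∫ x, a x * (f x * χ x) ∂α| ≤
        A * (normW1Inf f G).toReal * √(mixedEnergy α a).toReal := by
  obtain ⟨A, hA, h⟩ := exists_sq_integral_mul_le hd R
  have hL0 : 0 ≤ L := (norm_nonneg _).trans (hL 0)
  -- By the product rule, the gradient of the cut-off mollification is at most `M * L + M`,
  -- uniformly in the mollification radius.
  refine ⟨A * (1 + L), by positivity, fun α _ a ha hD f G hf hG hfin => ?_⟩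
  set M := (normW1Inf f G).toReal
  have hM0 : 0 ≤ M := ENNReal.toReal_nonneg
  have hM := abs_le_normW1Inf hf hfin
  let ρ : ℕ → ContDiffBump (0 : Rd d) := fun n =>
    ⟨1 / ((n : ℝ) + 1) / 2, 1 / ((n : ℝ) + 1), by positivity, half_lt_self (by positivity)⟩
  have hρ : Tendsto (fun n => (ρ n).rOut) atTop (𝓝 0) := tendsto_one_div_add_atTop_nhds_zero_nat
  have hlim : Tendsto (fun n => ∫ x, a x * (mollify (ρ n) f x * χ x) ∂α) atTop
      (𝓝 (∫ x, a x * (f x * χ x) ∂α)) := by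
    refine tendsto_integral_of_dominated_convergence (fun x => |a x| * M) (fun n => ?_)
      (ha.abs.mul_const M) (fun n => Eventually.of_forall fun x => ?_)
      (Eventually.of_forall fun x => ?_)
    · exact ha.1.mul ((contDiff_mollify (ρ n) hG.1).continuous.mul
        hχ.continuous).aestronglyMeasurable
    · rw [norm_mul, norm_mul]
      refine mul_le_mul_of_nonneg_left ?_ (abs_nonneg _)
      calc ‖mollify (ρ n) f x‖ * ‖χ x‖ ≤ M * 1 :=
            mul_le_mul (abs_mollify_le (ρ n) hM x) (h1 x) (norm_nonneg _) hM0
        _ = M := mul_one M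
    · exact ((ContDiffBump.convolution_tendsto_right_of_continuous hρ hf x).mul_const
        (χ x)).const_mul (a x)
  refine le_of_tendsto hlim.abs (Eventually.of_forall fun n => ?_)
  have hm := contDiff_mollify (ρ n) hG.1
  refine (h α a ha hD (fun x => mollify (ρ n) f x * χ x) (M * (1 + L)) (hm.mul hχ)
    ((tsupport_mul_subset_right).trans hR) fun x => ?_).trans_eq (by ring)
  have hfd : fderiv ℝ (fun x => mollify (ρ n) f x * χ x) x =
      mollify (ρ n) f x • fderiv ℝ χ x + χ x • fderiv ℝ (mollify (ρ n) f) x :=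
    fderiv_fun_mul (hm.differentiable (by simp) x) (hχ.differentiable (by simp) x)
  rw [hfd]
  refine (norm_add_le _ _).trans ?_
  rw [norm_smul, norm_smul]
  have i1 : ‖mollify (ρ n) f x‖ * ‖fderiv ℝ χ x‖ ≤ M * L :=
    mul_le_mul (abs_mollify_le (ρ n) hM x) (hL x) (norm_nonneg _) hM0
  have i2 : ‖χ x‖ * ‖fderiv ℝ (mollify (ρ n) f) x‖ ≤ 1 * M :=
    mul_le_mul (h1 x) (norm_fderiv_mollify_le (ρ n) hG (ae_norm_weakGradient_le hfin) hM0 x)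
      (norm_nonneg _) zero_le_one
  linarith

end Mollify

/-! ### Localization to a ball -/

section Main

variable {d : ℕ}

lemma exists_norm_fderiv_le {χ : Rd d → ℝ} (hχ : ContDiff ℝ ∞ χ) (hc : HasCompactSupport χ) :
    ∃ L : ℝ, ∀ x, ‖fderiv ℝ χ x‖ ≤ L :=
  (hc.fderiv (𝕜 := ℝ)).exists_bound_of_continuous (hχ.continuous_fderiv (by simp))

/-- The mass of a nonnegative function that vanishes on a set off which the density has a constant
sign is at most its pairing with the signed measure. -/
lemma integral_le_abs_integral_sign_mul {α : Measure (Rd d)} {σ η : Rd d → ℝ} {K : Set (Rd d)}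
    (hK : ∀ x ∈ K, η x = 0)
    (h : (∀ᵐ x ∂α, x ∉ K → σ x = 1) ∨ ∀ᵐ x ∂α, x ∉ K → σ x = -1) :
    ∫ x, η x ∂α ≤ |∫ x, σ x * η x ∂α| := by
  rcases h with h | h
  · refine (le_abs_self _).trans_eq (congrArg _ (integral_congr_ae ?_))
    filter_upwards [h] with x hx
    by_cases hxK : x ∈ K
    · simp [hK x hxK]
    · simp [hx hxK]
  · rw [← abs_neg, ← integral_neg]
    refine (le_abs_self _).trans_eq (congrArg _ (integral_congr_ae ?_))
    filter_upwards [h] with x hx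
    by_cases hxK : x ∈ K
    · simp [hK x hxK]
    · simp [hx hxK]

/-- The estimate on a large ball, in terms of the total variation and its sign. -/
lemma exists_abs_setIntegral_le (hd : 0 < d) {R : ℝ} (hR : 0 < R) :
    ∃ B : ℝ, 0 < B ∧ ∀ (α : Measure (Rd d)) [IsFiniteMeasure α] (σ : Rd d → ℝ), Measurable σ →
      (∀ x, |σ x| = 1) → ((∀ᵐ x ∂α, x ∉ Metric.closedBall (0 : Rd d) R → σ x = 1) ∨
        ∀ᵐ x ∂α, x ∉ Metric.closedBall (0 : Rd d) R → σ x = -1) → mixedEnergy α σ ≠ ⊤ →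
      ∀ (f : Rd d → ℝ) (G : Rd d → Rd d), Continuous f → HasWeakGradient f G →
      normW1Inf f G < ⊤ →
      |∫ x in Metric.closedBall (0 : Rd d) (R + 1), f x * σ x ∂α| ≤
        B * (normW1Inf f G).toReal * √(mixedEnergy α σ).toReal := by
  -- `χ₁` drops from `1` to `0` between radii `R` and `R + 1`, `χ` between `R + 1` and `R + 2`. Thus
  -- `η = χ (1 - χ₁)` vanishes on the ball of radius `R` and equals `χ` beyond radius `R + 1`.
  let χ₁ : ContDiffBump (0 : Rd d) := ⟨R, R + 1, hR, by linarith⟩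
  let χ : ContDiffBump (0 : Rd d) := ⟨R + 1, R + 2, by linarith, by linarith⟩
  have hχ1 : ContDiff ℝ ∞ χ₁ := χ₁.contDiff
  have hχ : ContDiff ℝ ∞ χ := χ.contDiff
  have hsupp : tsupport χ ⊆ Metric.closedBall 0 (R + 2) := χ.tsupport_eq.subset
  obtain ⟨L, hL⟩ := exists_norm_fderiv_le hχ χ.hasCompactSupport
  let η : Rd d → ℝ := fun x => χ x * (1 - χ₁ x)
  have hη : ContDiff ℝ ∞ η := hχ.mul (contDiff_const.sub hχ1)
  have hηs : tsupport η ⊆ Metric.closedBall 0 (R + 2) := tsupport_mul_subset_left.trans hsupp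
  have hη0 : ∀ x, 0 ≤ η x := fun x => mul_nonneg χ.nonneg (sub_nonneg.2 χ₁.le_one)
  have hη1 : ∀ x, η x ≤ 1 := fun x =>
    mul_le_one₀ χ.le_one (sub_nonneg.2 χ₁.le_one) (sub_le_self _ χ₁.nonneg)
  have hχabs : ∀ x, |χ x| ≤ 1 := fun x => by rw [abs_of_nonneg χ.nonneg]; exact χ.le_one
  obtain ⟨N, hN⟩ := exists_norm_fderiv_le hη χ.hasCompactSupport.mul_right
  have hN0 : 0 ≤ N := (norm_nonneg _).trans (hN 0)
  obtain ⟨A₁, hA₁, h₁⟩ := exists_abs_integral_mul_cutoff_le hd hχ hsupp hχabs hL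
  obtain ⟨A₂, hA₂, h₂⟩ := exists_sq_integral_mul_le hd (R + 2)
  refine ⟨A₁ + A₂ * N, by positivity, fun α _ σ hσm hσ hsgn hD f G hf hG hfin => ?_⟩
  have hσi : Integrable σ α := (integrable_const (1 : ℝ)).mono' hσm.aestronglyMeasurable
    (Eventually.of_forall fun x => (hσ x).le)
  set M := (normW1Inf f G).toReal
  have hM0 : 0 ≤ M := ENNReal.toReal_nonneg
  have hM := abs_le_normW1Inf hf hfin
  have e₁ := h₁ α σ hσi hD f G hf hG hfin
  have e₂ := (integral_le_abs_integral_sign_mul (α := α) (σ := σ) (η := η)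
    (K := Metric.closedBall 0 R) (fun x hx => by
      simp only [η, χ₁.one_of_mem_closedBall hx, sub_self, mul_zero]) hsgn).trans
    (h₂ α σ hσi hD η N hη hηs hN)
  have hηi : Integrable η α := (integrable_const (1 : ℝ)).mono'
    hη.continuous.aestronglyMeasurable
    (Eventually.of_forall fun x => by rw [Real.norm_of_nonneg (hη0 x)]; exact hη1 x)
  have hfσ : Integrable (fun x => f x * σ x) α := (integrable_const M).mono'
    (hf.aestronglyMeasurable.mul hσm.aestronglyMeasurable)
    (Eventually.of_forall fun x => by
      rw [norm_mul, Real.norm_eq_abs (σ x), hσ, mul_one]; exact hM x)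
  have hfχ : Integrable (fun x => σ x * (f x * χ x)) α := by
    refine (integrable_const M).mono' (hσm.aestronglyMeasurable.mul
      (hf.mul hχ.continuous).aestronglyMeasurable) (Eventually.of_forall fun x => ?_)
    rw [norm_mul, norm_mul, Real.norm_eq_abs (σ x), hσ, one_mul]
    exact (mul_le_mul (hM x) (hχabs x) (abs_nonneg _) hM0).trans_eq (mul_one M)
  -- Inside the ball of radius `R + 1` the two integrands agree; outside, their difference is at
  -- most `M χ = M η`.
  have e₃ : |∫ x in Metric.closedBall (0 : Rd d) (R + 1), f x * σ x ∂α -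
      ∫ x, σ x * (f x * χ x) ∂α| ≤ M * ∫ x, η x ∂α := by
    rw [← integral_indicator measurableSet_closedBall,
      ← integral_sub (hfσ.indicator measurableSet_closedBall) hfχ, ← integral_const_mul,
      ← Real.norm_eq_abs]
    refine norm_integral_le_of_norm_le (hηi.const_mul M) (Eventually.of_forall fun x => ?_)
    by_cases hx : x ∈ Metric.closedBall (0 : Rd d) (R + 1)
    · rw [indicator_of_mem hx, χ.one_of_mem_closedBall hx, mul_one, mul_comm, sub_self, norm_zero]
      exact mul_nonneg hM0 (hη0 x)
    · have h0 : χ₁ x = 0 := χ₁.zero_of_le_dist (by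
        rw [Metric.mem_closedBall, not_le] at hx
        exact hx.le)
      have hηx : η x = χ x := by simp [η, h0]
      rw [indicator_of_notMem hx, zero_sub, norm_neg, norm_mul, norm_mul, Real.norm_eq_abs (σ x),
        hσ, one_mul, hηx, Real.norm_of_nonneg χ.nonneg]
      exact mul_le_mul_of_nonneg_right (hM x) χ.nonneg
  have e₄ := mul_le_mul_of_nonneg_left e₂ hM0
  have e₅ := abs_sub_abs_le_abs_sub (∫ x in Metric.closedBall (0 : Rd d) (R + 1), f x * σ x ∂α)
    (∫ x, σ x * (f x * χ x) ∂α)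
  linarith

lemma blNorm_le_ofReal {ν : SignedMeasure (Rd d)} {B : ℝ}
    (h : ∀ (f : Rd d → ℝ) (G : Rd d → Rd d), Continuous f → HasWeakGradient f G →
      normW1Inf f G < ⊤ → ∫ᵛ x, f x ∂•ν ≤ B * (normW1Inf f G).toReal) :
    blNorm ν ≤ ENNReal.ofReal B := by
  refine iSup_le fun f => iSup_le fun G => iSup_le fun ⟨hf, hG, hfin⟩ => ?_
  refine ENNReal.div_le_of_le_mul ?_
  refine (ENNReal.ofReal_le_ofReal (h f G hf hG hfin)).trans_eq ?_
  rw [ENNReal.ofReal_mul' ENNReal.toReal_nonneg, ENNReal.ofReal_toReal hfin.ne]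

end Main

end CoulombBL

theorem mainTheorem4 (d : ℕ) (hd : 2 ≤ d) (K : Set (CoulombBL.Rd d)) (hK : IsCompact K)
    (hKC2 : CoulombBL.HasC2Boundary K) :
    ∃ K₂ : Set (CoulombBL.Rd d), IsCompact K₂ ∧ K ⊆ K₂ ∧ ∃ k : ℝ, 0 < k ∧
      ∀ μ : MeasureTheory.SignedMeasure (CoulombBL.Rd d),
        (d = 2 → μ Set.univ = 0) →
        (∀ x, μ {x} = 0) →
        ((∀ A, MeasurableSet A → A ⊆ Kᶜ → 0 ≤ μ A) ∨
          (∀ A, MeasurableSet A → A ⊆ Kᶜ → μ A ≤ 0)) →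
        CoulombBL.EnergyDefined μ →
        ((CoulombBL.blNorm (μ.restrict K₂) ^ 2 : ENNReal) : EReal) ≤
          (k : EReal) * CoulombBL.energy μ := by
  open CoulombBL in
  obtain ⟨R, hR, hKR⟩ := hK.isBounded.subset_closedBall_lt 0 0
  obtain ⟨B, hB, hmain⟩ := exists_abs_setIntegral_le (by omega : 0 < d) hR
  obtain ⟨C, hC, henergy⟩ := exists_energy_eq hd
  refine ⟨Metric.closedBall 0 (R + 1), isCompact_closedBall _ _,
    hKR.trans (Metric.closedBall_subset_closedBall (by linarith)), B ^ 2 / C, by positivity,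
    fun μ h2 hat hsgn hdef => ?_⟩
  obtain ⟨σ, hσ⟩ := exists_isSign μ
  rw [henergy μ σ hσ hat h2 hdef]
  change _ ≤ _ * ((ENNReal.ofReal C * mixedEnergy μ.totalVariation σ : ℝ≥0∞) : EReal)
  have hk : ((B ^ 2 / C : ℝ) : EReal) = (ENNReal.ofReal (B ^ 2 / C) : EReal) := by
    rw [EReal.coe_ennreal_ofReal, max_eq_left (by positivity)]
  rw [hk, ← EReal.coe_ennreal_mul, EReal.coe_ennreal_le_coe_ennreal_iff, ← mul_assoc,
    ← ENNReal.ofReal_mul (by positivity), div_mul_cancel₀ _ hC.ne']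
  -- The constant `k = B² / C` cancels the mixture constant, leaving `B²` times the mixed energy; if
  -- that is infinite nothing is left to prove.
  by_cases hD : mixedEnergy μ.totalVariation σ = ⊤
  · rw [hD, ENNReal.mul_top (by positivity)]
    exact le_top
  have hsgn' : (∀ᵐ x ∂μ.totalVariation, x ∉ Metric.closedBall (0 : Rd d) R → σ x = 1) ∨
      ∀ᵐ x ∂μ.totalVariation, x ∉ Metric.closedBall (0 : Rd d) R → σ x = -1 := by
    refine hsgn.imp (fun h => ?_) fun h => ?_
    · filter_upwards [hσ.ae_eq_one hK.measurableSet h] with x hx hxR using hx fun hxK => hxR (hKR hxK)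
    · filter_upwards [hσ.ae_eq_neg_one hK.measurableSet h] with x hx hxR using
        hx fun hxK => hxR (hKR hxK)
  have hbl := blNorm_le_ofReal (ν := μ.restrict (Metric.closedBall 0 (R + 1)))
    (B := B * √(mixedEnergy μ.totalVariation σ).toReal) fun f G hf hG hfin => by
      have hfi : Integrable f μ.totalVariation :=
        (integrable_const (normW1Inf f G).toReal).mono' hf.aestronglyMeasurable
          (Filter.Eventually.of_forall (abs_le_normW1Inf hf hfin))
      rw [hσ.integral_restrict measurableSet_closedBall hfi]
      refine (le_abs_self _).trans ((hmain μ.totalVariation σ hσ.measurable hσ.abs_eq_one hsgn' hD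
        f G hf hG hfin).trans_eq (by ring))
  calc blNorm (μ.restrict (Metric.closedBall 0 (R + 1))) ^ 2
      ≤ ENNReal.ofReal (B * √(mixedEnergy μ.totalVariation σ).toReal) ^ 2 := by gcongr
    _ = ENNReal.ofReal (B ^ 2) * mixedEnergy μ.totalVariation σ := by
      rw [← ENNReal.ofReal_pow (by positivity), mul_pow, Real.sq_sqrt ENNReal.toReal_nonneg,
        ENNReal.ofReal_mul (by positivity), ENNReal.ofReal_toReal hD]
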